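/- Let $d,b,m\ge 2$ be integers and $N=b^m$. *Hilbert curve.* A map $H:[0,1]\to[0,1]^d$ is called a Hilbert curve if for every $n\ge 0$ it maps the $2^{dn}$ consecutive intervals $[k2^{-dn},(k+1)2^{-dn}]$, $0\le k<2^{dn}$, onto the $2^{dn}$ closed dyadic subcubes of side $2^{-n}$ of $[0,1]^d$, distinct intervals onto distinct subcubes, and neighbouring intervals onto subcubes that share a $(d-1)$-dimensional face. Let $H$ be a Hilbert curve and put $I_i=[\frac{i-1}{N},\frac iN]$ and $E_i=H(I_i)$ for $i=1,\dots,N$. *Scrambled van der Corput points.* Write $i-1=\sum_{j\ge1}y_{ij}b^{j-1}$ with $y_{ij}\in\{0,\dots,b-1\}$. For each finite word $w$ over $\{0,\dots,b-1\}$ let $\pi_w$ be a random permutation of $\{0,\dots,b-1\}$, uniformly distributed over the $b!$ permutations, all $\pi_w$ being mutually independent. Put $x_i=\sum_{j\ge1}x_{ij}b^{-j}$ with $x_{ij}=\pi_{y_{i1}\dots y_{i,j-1}}(y_{ij})$. *Function space.* Let $\mathcal H^{\mathbf 1}(K)$ be the space of continuous functions $f$ on $[0,1]^d$ that vanish at every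 point having some coordinate equal to $1$ and have a weak mixed derivative $\frac{\partial^d f}{\partial x_1\cdots\partial x_d}\in L_2([0,1]^d)$, with $\|f\|^2_{\mathcal H^{\mathbf 1}(K)}=\int_{[0,1]^d}\big(\frac{\partial^d f}{\partial x_1\cdots\partial x_d}(t)\big)^2dt$; its reproducing kernel is $K(x,y)=\prod_{j=1}^d(1-\max(x_j,y_j))$. For $z_1,\dots,z_N\in[0,1]^d$ put $$e^2(z_1,\dots,z_N)=\sup_{f\in\mathcal H^{\mathbf 1}(K),\ \|f\|_{\mathcal H^{\mathbf 1}(K)}\le1}\Big|\frac1N\sum_{n=1}^Nf(z_n)-\int_{[0,1]^d}f(x)\,dx\Big|^2 .$$ Then: 1. $\{E_1,\dots,E_N\}$ is an equal-measure partition of $[0,1]^d$ up to null sets: $\bigcup_iE_i=[0,1]^d$, $\lambda(E_i)=1/N$ for all $i$, and $\lambda(E_i\cap E_j)=0$ for $i\ne j$. 2. If $X'_1,\dots,X'_N$ are independent random points with $X'_i$ uniformly distributed in $E_i$, then $e^2(X'_1,\dots,X'_N)$ is (almost everywhere) measurable and $$\mathbb E\big[e^2(X'_1,\dots,X'_N)\big]\le\frac{2d\sqrt{d+3}}{N^{1+\frac1d}}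 .$$ 3. The same holds for the Hilbert-space-filling-curve-based sample $X'_i=H(x_i)$, $i=1,\dots,N$, obtained from the scrambled van der Corput points. -/

import Mathlib

open MeasureTheory ProbabilityTheory
open scoped ENNReal

noncomputable section

namespace HSFC

/-! ### Hilbert space-filling curves in dimension `d` -/

/-- The unit cube `[0,1]^d`. -/
def unitCube (d : ℕ) : Set (EuclideanSpace ℝ (Fin d)) :=
  {x | ∀ j, 0 ≤ x j ∧ x j ≤ 1}

/-- The closed dyadic interval `[k/2ʳ, (k+1)/2ʳ]`. -/
def dyadicInterval (r k : ℕ) : Set ℝ :=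
  Set.Icc ((k : ℝ) / 2 ^ r) (((k : ℝ) + 1) / 2 ^ r)

/-- The closed dyadic subcube of `[0,1]^d` of side `2⁻ⁿ` with lower corner `p / 2ⁿ`. -/
def dyadicCube {d : ℕ} (n : ℕ) (p : Fin d → ℕ) : Set (EuclideanSpace ℝ (Fin d)) :=
  {x | ∀ j, (p j : ℝ) / 2 ^ n ≤ x j ∧ x j ≤ ((p j : ℝ) + 1) / 2 ^ n}

/-- The dyadic subcubes with lower corners `p / 2ⁿ` and `q / 2ⁿ` share a common
`(d-1)`-dimensional face: `p` and `q` differ in exactly one coordinate, and there by one. -/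
def FaceAdjacent {d : ℕ} (p q : Fin d → ℕ) : Prop :=
  ∃ j, (q j = p j + 1 ∨ p j = q j + 1) ∧ ∀ i, i ≠ j → p i = q i

/-- `H` (restricted to `[0,1]`) is a `d`-dimensional Hilbert curve: for every `n`, it maps the
`2^(dn)` consecutive intervals `[k/2^(dn), (k+1)/2^(dn)]` onto the `2^(dn)` closed dyadic subcubes
of side `2⁻ⁿ` of `[0,1]^d`, different intervals to different subcubes, and neighbouring intervals
to subcubes with a common face.  (The nesting of the subcubes of successive levels, the continuity
of `H` on `[0,1]`, and `H([0,1]) = [0,1]^d` are consequences.) -/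
def IsHilbertCurve {d : ℕ} (H : ℝ → EuclideanSpace ℝ (Fin d)) : Prop :=
  ∀ n : ℕ, ∃ p : ℕ → Fin d → ℕ,
    (∀ k < 2 ^ (d * n), ∀ j, p k j < 2 ^ n) ∧
    Set.InjOn p {k | k < 2 ^ (d * n)} ∧
    (∀ k, k + 1 < 2 ^ (d * n) → FaceAdjacent (p k) (p (k + 1))) ∧
    ∀ k < 2 ^ (d * n),
      H '' dyadicInterval (d * n) k = dyadicCube n (p k)

/-! ### The standard Hilbert curve

The Hilbert curve in the Gray-code form of Butz and Hamilton.  A cell of level `n` carries its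
position, the corner at which the curve enters it, and a cyclic shift of the coordinate axes; it is
traversed in the order of the binary reflected Gray code. -/

/-- Bit `j` of the `l`-th word of the binary reflected Gray code. -/
def gray (l j : ℕ) : Bool := xor (l.testBit j) (l.testBit (j + 1))

/-- Bit `j` of the corner at which the curve enters the `l`-th subcell (local coordinates). -/
def entryBit (l j : ℕ) : Bool := gray (2 * ((l - 1) / 2)) j

/-- The direction (local coordinates, modulo `d`) from entry to exit of the `l`-th subcell. -/
def direction (l : ℕ) : ℕ := padicValNat 2 (2 * ((l + 1) / 2))

/-- A cell of the Hilbert curve: integer position, entry corner, and shift of the axes. -/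
structure Cell (d : ℕ) where
  pos : Fin d → ℕ
  entry : Fin d → Bool
  shift : Fin d

/-- The `l`-th subcell, `l < 2^d`, of a cell. -/
def Cell.child {d : ℕ} [NeZero d] (c : Cell d) (l : ℕ) : Cell d where
  pos j := 2 * c.pos j + (xor (c.entry j) (gray l (j - c.shift : Fin d))).toNat
  entry j := xor (c.entry j) (entryBit l (j - c.shift : Fin d))
  shift := c.shift + (Fin.ofNat d (direction l) + 1)

/-- The `k`-th cell, `k < 2^(dn)`, of level `n`. -/
def cell (d : ℕ) [NeZero d] : ℕ → ℕ → Cell d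
  | 0, _ => ⟨fun _ => 0, fun _ => false, 0⟩
  | n + 1, k => (cell d n (k / 2 ^ d)).child (k % 2 ^ d)

/-- The index of the interval of level `n` that contains `x ∈ [0,1]`. -/
def cellIndex (d n : ℕ) (x : ℝ) : ℕ := min ⌊x * 2 ^ (d * n)⌋₊ (2 ^ (d * n) - 1)

/-- The standard `d`-dimensional Hilbert curve: `x` is sent to the limit of the lower corners of the
cells whose intervals contain `x`. -/
def hilbertCurve (d : ℕ) [NeZero d] (x : ℝ) : EuclideanSpace ℝ (Fin d) :=
  WithLp.toLp 2 fun j => ⨆ n, ((cell d n (cellIndex d n x)).pos j : ℝ) / 2 ^ n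

/-! ### Hilbert-curve-based stratified sampling -/

/-- The stratum `E_i = H(I_i)` with `I_i = [i/N, (i+1)/N]`, `i = 0, …, N-1`. -/
def stratum {d : ℕ} (H : ℝ → EuclideanSpace ℝ (Fin d)) (N i : ℕ) :
    Set (EuclideanSpace ℝ (Fin d)) :=
  H '' Set.Icc ((i : ℝ) / N) (((i : ℝ) + 1) / N)

/-- The `j`-th base-`b` digit of `i`, i.e. the coefficient of `b^j` in `i`, and of `b^(-j-1)` in the
`i`-th point (`i = 0, 1, …`) of the van der Corput sequence in base `b`. -/
def vdcDigit (b : ℕ) [NeZero b] (i j : ℕ) : Fin b := Fin.ofNat b (i / b ^ j)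

/-- The `j`-th digit of the scrambled `i`-th point: the permutation attached to the preceding digits
of the van der Corput point is applied to its `j`-th digit. -/
def scrambledDigit {b : ℕ} [NeZero b] (π : List (Fin b) → Equiv.Perm (Fin b)) (i j : ℕ) : Fin b :=
  π ((List.range j).map (vdcDigit b i)) (vdcDigit b i j)

/-- The scrambled `i`-th point of the van der Corput sequence in base `b`. -/
def scrambledPoint {b : ℕ} [NeZero b] (π : List (Fin b) → Equiv.Perm (Fin b)) (i : ℕ) : ℝ :=
  ∑' j : ℕ, ((scrambledDigit π i j : ℕ) : ℝ) / (b : ℝ) ^ (j + 1)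

/-- The random permutations `π w`, indexed by the finite words `w` of digits, are mutually
independent and uniformly distributed over the `b!` permutations of the digits. -/
structure IsUniformScrambling {Ω : Type*} [MeasurableSpace Ω] {b : ℕ}
    (π : List (Fin b) → Ω → Equiv.Perm (Fin b)) (P : Measure Ω) : Prop where
  measurableSet_eq : ∀ w σ, MeasurableSet {ω | π w ω = σ}
  uniform : ∀ w σ, P {ω | π w ω = σ} = (b.factorial : ℝ≥0∞)⁻¹
  indep : iIndepFun (β := fun _ => Equiv.Perm (Fin b)) (m := fun _ => ⊤) π P

/-! ### The Sobolev space `H^1(K)` and the worst-case error -/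

/-- Lebesgue measure on the unit cube. -/
def cubeMeasure (d : ℕ) : Measure (EuclideanSpace ℝ (Fin d)) := volume.restrict (unitCube d)

/-- The mixed partial derivative `∂^d φ / ∂x_1 ⋯ ∂x_d` of a smooth function. -/
def mixedPartial {d : ℕ} (φ : EuclideanSpace ℝ (Fin d) → ℝ) (x : EuclideanSpace ℝ (Fin d)) : ℝ :=
  iteratedFDeriv ℝ d φ x fun j => EuclideanSpace.single j 1

/-- Smooth functions with compact support in the open unit cube. -/
def IsTestFunction {d : ℕ} (φ : EuclideanSpace ℝ (Fin d) → ℝ) : Prop :=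
  ContDiff ℝ ((⊤ : ℕ∞) : WithTop ℕ∞) φ ∧ HasCompactSupport φ ∧ tsupport φ ⊆ {x | ∀ j, 0 < x j ∧ x j < 1}

/-- `g` is the weak mixed derivative `∂^d f / ∂x_1 ⋯ ∂x_d` on the unit cube. -/
def IsWeakMixedDeriv {d : ℕ} (f g : EuclideanSpace ℝ (Fin d) → ℝ) : Prop :=
  ∀ φ, IsTestFunction φ →
    ∫ x, f x * mixedPartial φ x ∂(cubeMeasure d) = (-1) ^ d * ∫ x, g x * φ x ∂(cubeMeasure d)

/-- The Sobolev space `H^1(K)` with reproducing kernel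
`K(x,y) = ∫ 1_{(x,1]}(t) 1_{(y,1]}(t) dt = ∏ j, (1 - max (x j) (y j))`: the continuous functions
on `[0,1]^d` that vanish wherever some coordinate is `1` and have a square-integrable weak mixed
derivative `∂^d f / ∂x_1 ⋯ ∂x_d`.  (Only the values of `f` on the unit cube matter.) -/
structure MemH1 {d : ℕ} (f : EuclideanSpace ℝ (Fin d) → ℝ) : Prop where
  continuousOn : ContinuousOn f (unitCube d)
  eq_zero : ∀ x ∈ unitCube d, (∃ j, x j = 1) → f x = 0
  exists_deriv : ∃ g, MemLp g 2 (cubeMeasure d) ∧ IsWeakMixedDeriv f g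

open Classical in
/-- The square-integrable weak mixed derivative (unique almost everywhere on the cube). -/
def weakMixedDeriv {d : ℕ} (f : EuclideanSpace ℝ (Fin d) → ℝ) : EuclideanSpace ℝ (Fin d) → ℝ :=
  if h : ∃ g, MemLp g 2 (cubeMeasure d) ∧ IsWeakMixedDeriv f g then h.choose else 0

/-- The inner product `∫ (∂^d f / ∂x) (∂^d g / ∂x)` of `H^1(K)`. -/
def h1Inner {d : ℕ} (f g : EuclideanSpace ℝ (Fin d) → ℝ) : ℝ :=
  ∫ t, weakMixedDeriv f t * weakMixedDeriv g t ∂(cubeMeasure d)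

/-- The norm of `H^1(K)`. -/
def h1Norm {d : ℕ} (f : EuclideanSpace ℝ (Fin d) → ℝ) : ℝ := √(h1Inner f f)

/-- The squared worst-case integration error of the points `x 0, …, x (N-1)` over the unit ball of
`H^1(K)`, as an extended nonnegative real. -/
def sqWorstCaseError {d N : ℕ} (x : Fin N → EuclideanSpace ℝ (Fin d)) : ℝ≥0∞ :=
  ⨆ (f : EuclideanSpace ℝ (Fin d) → ℝ) (_ : MemH1 f ∧ h1Norm f ≤ 1),
    ENNReal.ofReal (|1 / (N : ℝ) * ∑ n, f (x n) - ∫ t, f t ∂(cubeMeasure d)| ^ 2)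

/-! ### The standard Hilbert curve is a Hilbert curve -/

section Existence

variable {d : ℕ} [NeZero d]

set_option linter.unusedSectionVars false

lemma gray_succ (l j : ℕ) :
    gray (l + 1) j = xor (gray l j) (decide (j = padicValNat 2 (l + 1))) := by
  induction l using Nat.strong_induction_on generalizing j with
  | _ l ih =>
  rcases Nat.even_or_odd' l with ⟨t, rfl | rfl⟩
  · have hv : padicValNat 2 (2 * t + 1) = 0 := by
      apply padicValNat.eq_zero_of_not_dvd; omega
    rw [hv]
    have hb : ∀ i, (2 * t + 1).testBit (i + 1) = (2 * t).testBit (i + 1) := by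
      intro i
      rw [Nat.testBit_succ, Nat.testBit_succ]; congr 1; omega
    cases j with
    | zero =>
      have h0 : (2 * t + 1).testBit 0 = true := by simp
      have h1 : (2 * t).testBit 0 = false := by simp
      simp only [gray, hb, h0, h1]; cases (2 * t).testBit 1 <;> simp
    | succ j => simp [gray, hb]
  · have hv : padicValNat 2 (2 * t + 1 + 1) = padicValNat 2 (t + 1) + 1 := by
      rw [show 2 * t + 1 + 1 = 2 * (t + 1) by ring, padicValNat.mul (by norm_num) (by omega)]
      simp [add_comm]
    rw [hv]
    have hb : ∀ i, (2 * t + 1 + 1).testBit (i + 1) = (t + 1).testBit i := by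
      intro i
      rw [Nat.testBit_succ]; congr 1; omega
    have hb' : ∀ i, (2 * t + 1).testBit (i + 1) = t.testBit i := by
      intro i
      rw [Nat.testBit_succ]; congr 1; omega
    cases j with
    | zero =>
      have h0 : (2 * t + 1 + 1).testBit 0 = false := by
        simp [Nat.testBit_zero]; omega
      have h1 : (2 * t + 1).testBit 0 = true := by simp
      have h2 : (t + 1).testBit 0 = !(t.testBit 0) := by
        simp only [Nat.testBit_zero]
        rcases Nat.mod_two_eq_zero_or_one t with h | h <;> simp [h] <;> omega
      simp only [gray, hb, hb', h0, h1, h2]; cases t.testBit 0 <;> simp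
    | succ j =>
      have := ih t (by omega) j
      simp only [gray] at this
      simp only [gray, hb, hb', this]
      simp

lemma gray_zero (j : ℕ) : gray 0 j = false := by simp [gray]

lemma gray_injOn {m l l' : ℕ} (hl : l < 2 ^ m) (hl' : l' < 2 ^ m)
    (h : ∀ j < m, gray l j = gray l' j) : l = l' := by
  have key : ∀ i ≤ m, l.testBit (m - i) = l'.testBit (m - i) := by
    intro i
    induction i with
    | zero => intro _; simp [Nat.testBit_lt_two_pow hl, Nat.testBit_lt_two_pow hl']
    | succ i ih =>
      intro hi
      have h1 := ih (by omega)
      have h2 := h (m - (i + 1)) (by omega)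
      rw [gray, gray, show m - (i + 1) + 1 = m - i by omega, h1] at h2
      simpa using h2
  apply Nat.eq_of_testBit_eq
  intro i
  by_cases hi : i ≤ m
  · have := key (m - i) (by omega)
    rwa [show m - (m - i) = i by omega] at this
  · have hp : 2 ^ m ≤ 2 ^ i := Nat.pow_le_pow_right (by norm_num) (by omega)
    rw [Nat.testBit_lt_two_pow (by omega), Nat.testBit_lt_two_pow (by omega)]

lemma gray_last {m j : ℕ} (hj : j < m) :
    gray (2 ^ m - 1) j = decide (j = m - 1) := by
  simp only [gray, Nat.testBit_two_pow_sub_one, hj]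
  by_cases h : j + 1 < m
  · simp [h]; omega
  · simp [h]; omega

/-- Bit `j` of the exit corner of the `l`-th subcell, in local coordinates. -/
lemma exit_even {t j : ℕ} :
    xor (entryBit (2 * t) j) (decide (j = direction (2 * t))) = gray (2 * t + 1) j := by
  have hv : padicValNat 2 (2 * t + 1) = 0 := by
    apply padicValNat.eq_zero_of_not_dvd; omega
  rw [gray_succ, hv]
  cases t with
  | zero => simp [entryBit, direction]
  | succ t =>
    have hv' : padicValNat 2 (2 * t + 1) = 0 := by
      apply padicValNat.eq_zero_of_not_dvd; omega
    rw [show 2 * (t + 1) = 2 * t + 1 + 1 by ring, gray_succ, gray_succ, hv', entryBit, direction,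
      show 2 * ((2 * t + 1 + 1 - 1) / 2) = 2 * t by omega,
      show 2 * ((2 * t + 1 + 1 + 1) / 2) = 2 * t + 1 + 1 by omega]
    cases gray (2 * t) j <;> cases decide (j = 0) <;>
      cases decide (j = padicValNat 2 (2 * t + 1 + 1)) <;> rfl

/-- The corner at which the curve leaves a cell. -/
def Cell.exit (c : Cell d) (j : Fin d) : Bool :=
  xor (c.entry j) (decide (j - c.shift = -1))

/-- Consecutive cells: adjacent along one axis, with matching exit and entry corners. -/
def Linked (A B : Cell d) : Prop :=
  ∃ g, ((B.pos g = A.pos g + 1 ∧ A.exit g = true ∧ B.entry g = false) ∨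
      (A.pos g = B.pos g + 1 ∧ A.exit g = false ∧ B.entry g = true)) ∧
    ∀ i, i ≠ g → A.pos i = B.pos i ∧ A.exit i = B.entry i

lemma val_neg_one : ((-1 : Fin d) : ℕ) = d - 1 := by
  obtain ⟨n, rfl⟩ := Nat.exists_eq_succ_of_ne_zero (NeZero.ne d)
  have : Fin.last n = -1 := eq_neg_of_add_eq_zero_left (Fin.last_add_one n)
  exact (congrArg Fin.val this).symm

lemma child_exit (c : Cell d) (l : ℕ) (j : Fin d) :
    (c.child l).exit j = xor (xor (c.entry j) (entryBit l (j - c.shift : Fin d)))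
      (decide (j - c.shift = Fin.ofNat d (direction l))) := by
  simp only [Cell.exit, Cell.child]
  congr 2
  rw [eq_iff_iff]
  constructor
  · intro h
    have : j - c.shift = (j - (c.shift + (Fin.ofNat d (direction l) + 1))) +
      Fin.ofNat d (direction l) + 1 := by abel
    rw [this, h]; abel
  · intro h
    rw [show j - (c.shift + (Fin.ofNat d (direction l) + 1)) =
      (j - c.shift) - Fin.ofNat d (direction l) - 1 by abel, h]; abel

lemma padic_lt {m l : ℕ} (h : l + 1 < 2 ^ m) : padicValNat 2 (l + 1) < m := by
  have h1 : 2 ^ padicValNat 2 (l + 1) ≤ l + 1 := Nat.le_of_dvd (by omega) pow_padicValNat_dvd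
  by_contra hc
  have : 2 ^ m ≤ 2 ^ padicValNat 2 (l + 1) := Nat.pow_le_pow_right (by norm_num) (by omega)
  omega

lemma eq_ofNat_iff {v : ℕ} (hv : v < d) (i : Fin d) : i = Fin.ofNat d v ↔ (i : ℕ) = v := by
  rw [Fin.ext_iff, Fin.val_ofNat, Nat.mod_eq_of_lt hv]

lemma linked_siblings (c : Cell d) {l : ℕ} (hl : l + 1 < 2 ^ d) :
    Linked (c.child l) (c.child (l + 1)) := by
  have hv := padic_lt hl
  set v := padicValNat 2 (l + 1) with hvdef
  have hg : ∀ j : Fin d, gray (l + 1) (j - c.shift : Fin d) =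
      xor (gray l (j - c.shift : Fin d)) (decide (((j - c.shift : Fin d) : ℕ) = v)) :=
    fun j => gray_succ l _
  -- exit corner of one subcell and entry corner of the next
  have hex : ∀ j : Fin d, xor (xor (entryBit l (j - c.shift : Fin d))
        (decide (j - c.shift = Fin.ofNat d (direction l)))) (entryBit (l + 1) (j - c.shift : Fin d)) =
        decide (((j - c.shift : Fin d) : ℕ) = v) ∧
      (((j - c.shift : Fin d) : ℕ) = v →
        entryBit (l + 1) (j - c.shift : Fin d) = gray l (j - c.shift : Fin d)) := by
    intro j
    generalize (j - c.shift : Fin d) = i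
    rcases Nat.even_or_odd' l with ⟨t, rfl | rfl⟩
    · have hv0 : v = 0 := by
        rw [hvdef]; apply padicValNat.eq_zero_of_not_dvd; omega
      have hdir : direction (2 * t) < d := by
        rw [direction, show 2 * ((2 * t + 1) / 2) = 2 * t by omega]
        rcases Nat.eq_zero_or_pos t with rfl | ht
        · simpa using Nat.pos_of_ne_zero (NeZero.ne d)
        · have := padic_lt (m := d) (l := 2 * t - 1) (by omega)
          rwa [show 2 * t - 1 + 1 = 2 * t by omega] at this
      have he : entryBit (2 * t + 1) (i : ℕ) = gray (2 * t) i := by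
        rw [entryBit]; congr 1; omega
      simp only [eq_ofNat_iff hdir, exit_even, he, gray_succ (2 * t), ← hvdef]
      refine ⟨?_, fun _ => trivial⟩
      cases gray (2 * t) (i : ℕ) <;> simp
    · have hdir : direction (2 * t + 1) = v := by
        rw [direction, hvdef]; congr 1; omega
      have he : entryBit (2 * t + 1 + 1) (i : ℕ) = gray (2 * t) i := by
        rw [entryBit]; congr 1; omega
      have he' : entryBit (2 * t + 1) (i : ℕ) = gray (2 * t) i := by
        rw [entryBit]; congr 1; omega
      rw [hdir, he, he']
      simp only [eq_ofNat_iff hv]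
      refine ⟨?_, ?_⟩
      · cases gray (2 * t) (i : ℕ) <;> simp
      · intro hi
        have hv0 : padicValNat 2 (2 * t + 1) = 0 := by
          apply padicValNat.eq_zero_of_not_dvd; omega
        have hv1 : v ≠ 0 := by
          rw [hvdef]
          have : 1 ≤ padicValNat 2 (2 * t + 1 + 1) :=
            one_le_padicValNat_of_dvd (by omega) (by omega)
          omega
        rw [gray_succ, hv0]
        simp [hi, hv1]
  refine ⟨Fin.ofNat d v + c.shift, ?_, ?_⟩
  · have hi : ((Fin.ofNat d v + c.shift - c.shift : Fin d) : ℕ) = v := by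
      rw [add_sub_cancel_right, Fin.val_ofNat, Nat.mod_eq_of_lt hv]
    obtain ⟨h1, h2⟩ := hex (Fin.ofNat d v + c.shift)
    have h3 := hg (Fin.ofNat d v + c.shift)
    have h2 := h2 hi
    rw [child_exit]
    simp only [Cell.child]
    simp only [hi, decide_true] at h1 h2 h3 ⊢
    rw [h3]
    rw [h2] at h1 ⊢
    revert h1
    generalize c.entry _ = a
    generalize gray l v = b
    generalize entryBit l v = e
    generalize decide (_ = Fin.ofNat d (direction l)) = f
    revert a b e f
    generalize c.pos _ = q
    intro a b e f
    cases a <;> cases b <;> cases e <;> cases f <;> simp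
  · intro j hj
    have hi : ((j - c.shift : Fin d) : ℕ) ≠ v := by
      intro h
      apply hj
      rw [← (eq_ofNat_iff hv _).2 h]; abel
    obtain ⟨h1, -⟩ := hex j
    have h3 := hg j
    rw [child_exit]
    simp only [Cell.child]
    simp only [hi, decide_false, Bool.xor_false] at h1 h3
    rw [h3]
    refine ⟨rfl, ?_⟩
    revert h1
    generalize c.entry _ = a
    generalize entryBit l _ = e
    generalize entryBit (l + 1) _ = e'
    generalize decide (_ = Fin.ofNat d (direction l)) = f
    cases a <;> cases e <;> cases e' <;> cases f <;> simp

lemma child_last_pos (c : Cell d) (j : Fin d) :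
    (c.child (2 ^ d - 1)).pos j = 2 * c.pos j + (c.exit j).toNat := by
  simp only [Cell.child, Cell.exit]
  rw [gray_last (j - c.shift).isLt]
  congr 4
  rw [eq_iff_iff, Fin.ext_iff, val_neg_one]

lemma child_last_exit (c : Cell d) (j : Fin d) :
    (c.child (2 ^ d - 1)).exit j = c.exit j := by
  have hd : 0 < d := Nat.pos_of_ne_zero (NeZero.ne d)
  rw [child_exit, Cell.exit]
  have h2 : 2 ^ d = 2 * 2 ^ (d - 1) := by
    rw [← pow_succ']; congr 1; omega
  have h1 : 1 ≤ 2 ^ (d - 1) := Nat.one_le_two_pow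
  have hdir : Fin.ofNat d (direction (2 ^ d - 1)) = 0 := by
    rw [direction, show 2 * ((2 ^ d - 1 + 1) / 2) = 2 ^ d by omega, padicValNat.prime_pow]
    ext; rw [Fin.val_ofNat, Nat.mod_self, Fin.val_zero]
  have he : entryBit (2 ^ d - 1) (j - c.shift : Fin d) =
      xor (decide (((j - c.shift : Fin d) : ℕ) = d - 1)) (decide (((j - c.shift : Fin d) : ℕ) = 0)) := by
    have hg := gray_succ (2 ^ d - 2) (j - c.shift : Fin d)
    rw [show 2 ^ d - 2 + 1 = 2 ^ d - 1 by omega, gray_last (j - c.shift).isLt,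
      padicValNat.eq_zero_of_not_dvd (by omega)] at hg
    rw [entryBit, show 2 * ((2 ^ d - 1 - 1) / 2) = 2 ^ d - 2 by omega, hg]
    generalize gray _ _ = a
    cases a <;> simp
  have e1 : (j - c.shift = 0) ↔ (((j - c.shift : Fin d) : ℕ) = 0) := by rw [Fin.ext_iff, Fin.val_zero]
  have e2 : (j - c.shift = -1) ↔ (((j - c.shift : Fin d) : ℕ) = d - 1) := by
    rw [Fin.ext_iff, val_neg_one]
  rw [hdir, he]
  simp only [e1, e2]
  cases c.entry j <;> cases decide (((j - c.shift : Fin d) : ℕ) = d - 1) <;>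
    cases decide (((j - c.shift : Fin d) : ℕ) = 0) <;> rfl

lemma linked_cousins {A B : Cell d} (h : Linked A B) :
    Linked (A.child (2 ^ d - 1)) (B.child 0) := by
  obtain ⟨g, hg, hi⟩ := h
  have hp : ∀ j, (B.child 0).pos j = 2 * B.pos j + (B.entry j).toNat := by
    intro j; simp [Cell.child, gray_zero]
  have he : ∀ j, (B.child 0).entry j = B.entry j := by
    intro j; simp [Cell.child, entryBit, gray_zero]
  refine ⟨g, ?_, ?_⟩
  · rw [child_last_pos, child_last_exit, hp, he]
    rcases hg with ⟨h1, h2, h3⟩ | ⟨h1, h2, h3⟩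
    · left; rw [h1, h2, h3]; simp; ring
    · right; rw [h1, h2, h3]; simp; ring
  · intro i hne
    obtain ⟨h1, h2⟩ := hi i hne
    rw [child_last_pos, child_last_exit, hp, he, h1, h2]
    exact ⟨rfl, rfl⟩

lemma cell_linked (n k : ℕ) (hk : k + 1 < 2 ^ (d * n)) :
    Linked (cell d n k) (cell d n (k + 1)) := by
  induction n generalizing k with
  | zero => simp at hk
  | succ n ih =>
    have hpos : 0 < 2 ^ d := by positivity
    rw [show d * (n + 1) = d + d * n by ring, pow_add] at hk
    simp only [cell]
    by_cases h : k % 2 ^ d + 1 < 2 ^ d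
    · have hdm := Nat.div_add_mod k (2 ^ d)
      have h1 : (k + 1) / 2 ^ d = k / 2 ^ d := by
        rw [Nat.div_eq_of_lt_le]
        · rw [mul_comm]; omega
        · rw [add_mul, mul_comm]; omega
      have h2 : (k + 1) % 2 ^ d = k % 2 ^ d + 1 := by
        have := Nat.div_add_mod (k + 1) (2 ^ d)
        rw [h1] at this; omega
      rw [h1, h2]
      exact linked_siblings _ h
    · have hlt := Nat.mod_lt k hpos
      have hdm := Nat.div_add_mod k (2 ^ d)
      have h0 : k + 1 = 2 ^ d * (k / 2 ^ d + 1) := by rw [mul_add]; omega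
      have h1 : (k + 1) / 2 ^ d = k / 2 ^ d + 1 := by
        rw [h0]; exact Nat.mul_div_cancel_left _ hpos
      have h2 : (k + 1) % 2 ^ d = 0 := by rw [h0]; simp
      rw [h1, h2, show k % 2 ^ d = 2 ^ d - 1 by omega]
      apply linked_cousins
      apply ih
      rw [h0] at hk
      exact Nat.lt_of_mul_lt_mul_left hk

lemma cell_pos_lt (n k : ℕ) (j : Fin d) : (cell d n k).pos j < 2 ^ n := by
  induction n generalizing k with
  | zero => simp [cell]
  | succ n ih =>
    have := ih (k / 2 ^ d)
    simp only [cell, Cell.child]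
    have hb : (xor ((cell d n (k / 2 ^ d)).entry j)
      (gray (k % 2 ^ d) (j - (cell d n (k / 2 ^ d)).shift : Fin d))).toNat ≤ 1 := Bool.toNat_le _
    rw [pow_succ]; omega

lemma child_pos_inj {c : Cell d} {l l' : ℕ} (hl : l < 2 ^ d) (hl' : l' < 2 ^ d)
    (h : (c.child l).pos = (c.child l').pos) : l = l' := by
  apply gray_injOn hl hl'
  intro i hi
  have h1 := congrFun h (⟨i, hi⟩ + c.shift)
  simp only [Cell.child, add_sub_cancel_right, Nat.add_left_cancel_iff] at h1
  revert h1
  cases c.entry _ <;> cases gray l i <;> cases gray l' i <;> simp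

lemma cell_injOn (n : ℕ) :
    Set.InjOn (fun k => (cell d n k).pos) {k | k < 2 ^ (d * n)} := by
  induction n with
  | zero => intro k hk k' hk' _; simp at hk hk'; omega
  | succ n ih =>
    intro k hk k' hk' h
    have hpos : 0 < 2 ^ d := by positivity
    simp only [Set.mem_ofPred_eq, show d * (n + 1) = d + d * n by ring, pow_add] at hk hk'
    have h1 : k / 2 ^ d = k' / 2 ^ d := by
      apply ih (Nat.div_lt_of_lt_mul hk) (Nat.div_lt_of_lt_mul hk')
      funext j
      change (cell d n (k / 2 ^ d)).pos j = (cell d n (k' / 2 ^ d)).pos j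
      have := congrFun h j
      simp only [cell, Cell.child] at this
      have hb := Bool.toNat_le (xor ((cell d n (k / 2 ^ d)).entry j)
        (gray (k % 2 ^ d) (j - (cell d n (k / 2 ^ d)).shift : Fin d)))
      have hb' := Bool.toNat_le (xor ((cell d n (k' / 2 ^ d)).entry j)
        (gray (k' % 2 ^ d) (j - (cell d n (k' / 2 ^ d)).shift : Fin d)))
      omega
    have h2 : k % 2 ^ d = k' % 2 ^ d := by
      apply child_pos_inj (c := cell d n (k / 2 ^ d)) (Nat.mod_lt _ hpos) (Nat.mod_lt _ hpos)
      simp only [cell] at h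
      rw [h, h1]
    rw [← Nat.div_add_mod k (2 ^ d), h1, h2, Nat.div_add_mod]

lemma cellIndex_lt (n : ℕ) (x : ℝ) : cellIndex d n x < 2 ^ (d * n) := by
  have : 0 < 2 ^ (d * n) := by positivity
  rw [cellIndex]; omega

lemma cellIndex_div (n r : ℕ) (x : ℝ) :
    cellIndex d (n + r) x / 2 ^ (d * r) = cellIndex d n x := by
  have hpos : 0 < 2 ^ (d * r) := by positivity
  have hm : Monotone fun k : ℕ => k / 2 ^ (d * r) := fun a b h => Nat.div_le_div_right h
  have h1 : ⌊x * 2 ^ (d * (n + r))⌋₊ / 2 ^ (d * r) = ⌊x * 2 ^ (d * n)⌋₊ := by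
    rw [← Nat.floor_div_natCast]
    congr 1
    rw [mul_add, pow_add]; push_cast
    field_simp
  have h2 : (2 ^ (d * (n + r)) - 1) / 2 ^ (d * r) = 2 ^ (d * n) - 1 := by
    have h3 : 0 < 2 ^ (d * n) := by positivity
    have h4 : 2 ^ (d * (n + r)) = 2 ^ (d * n) * 2 ^ (d * r) := by rw [mul_add, pow_add]
    have h5 : 1 ≤ 2 ^ (d * n) * 2 ^ (d * r) := Nat.mul_pos h3 hpos
    apply Nat.div_eq_of_lt_le
    · rw [h4, Nat.sub_mul, one_mul]; omega
    · rw [h4, Nat.sub_add_cancel h3]; omega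
  rw [cellIndex, hm.map_min (a := ⌊x * 2 ^ (d * (n + r))⌋₊), cellIndex, ← h1, ← h2]

lemma dyadicCube_child (n : ℕ) (c : Cell d) (l : ℕ) :
    dyadicCube (n + 1) (c.child l).pos ⊆ dyadicCube n c.pos := by
  intro x hx j
  obtain ⟨h1, h2⟩ := hx j
  simp only [Cell.child] at h1 h2
  have hb := Bool.toNat_le (xor (c.entry j) (gray l (j - c.shift : Fin d)))
  generalize (xor (c.entry j) (gray l (j - c.shift : Fin d))).toNat = b at h1 h2 hb
  have hb' : (b : ℝ) ≤ 1 := by exact_mod_cast hb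
  have hb0 : (0 : ℝ) ≤ b := by positivity
  push_cast at h1 h2
  have h2n : (0 : ℝ) < 2 ^ n := by positivity
  rw [pow_succ] at h1 h2
  rw [div_le_iff₀ (by positivity)] at h1
  rw [le_div_iff₀ (by positivity)] at h2
  rw [div_le_iff₀ (by positivity), le_div_iff₀ (by positivity)]
  constructor <;> linarith

lemma dyadicCube_desc (n r k : ℕ) :
    dyadicCube (n + r) (cell d (n + r) k).pos ⊆ dyadicCube n (cell d n (k / 2 ^ (d * r))).pos := by
  induction r generalizing k with
  | zero => simp
  | succ r ih =>
    refine (dyadicCube_child (n + r) (cell d (n + r) (k / 2 ^ d)) (k % 2 ^ d)).trans ?_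
    refine (ih (k / 2 ^ d)).trans ?_
    rw [Nat.div_div_eq_div_mul, mul_add, mul_one, pow_add, mul_comm (2 ^ d)]

lemma corner_mem (n : ℕ) (p : Fin d → ℕ) :
    WithLp.toLp 2 (fun j => (p j : ℝ) / 2 ^ n) ∈ dyadicCube n p := by
  intro j
  refine ⟨le_rfl, ?_⟩
  change (p j : ℝ) / 2 ^ n ≤ _
  gcongr; linarith

lemma hilbertCurve_mem (n : ℕ) (x : ℝ) :
    hilbertCurve d x ∈ dyadicCube n (cell d n (cellIndex d n x)).pos := by
  have key : ∀ m r, ∀ j, ((cell d m (cellIndex d m x)).pos j : ℝ) / 2 ^ m ≤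
      ((cell d (m + r) (cellIndex d (m + r) x)).pos j : ℝ) / 2 ^ (m + r) ∧
      ((cell d (m + r) (cellIndex d (m + r) x)).pos j : ℝ) / 2 ^ (m + r) ≤
      (((cell d m (cellIndex d m x)).pos j : ℝ) + 1) / 2 ^ m := by
    intro m r j
    have := dyadicCube_desc (d := d) m r (cellIndex d (m + r) x) (corner_mem _ _)
    rw [cellIndex_div] at this
    exact this j
  have hup : ∀ m j, ((cell d m (cellIndex d m x)).pos j : ℝ) / 2 ^ m ≤
      (((cell d n (cellIndex d n x)).pos j : ℝ) + 1) / 2 ^ n := by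
    intro m j
    rcases le_total n m with h | h
    · obtain ⟨r, rfl⟩ := Nat.exists_eq_add_of_le h
      exact (key n r j).2
    · obtain ⟨r, rfl⟩ := Nat.exists_eq_add_of_le h
      refine (key m r j).1.trans ?_
      gcongr; linarith
  intro j
  refine ⟨?_, ?_⟩
  · exact le_ciSup (f := fun m => ((cell d m (cellIndex d m x)).pos j : ℝ) / 2 ^ m)
      ⟨_, by rintro _ ⟨m, rfl⟩; exact hup m j⟩ n
  · exact ciSup_le fun m => hup m j

lemma hilbertCurve_mem_of_mem (n k : ℕ) (hk : k < 2 ^ (d * n)) (x : ℝ)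
    (hx : x ∈ dyadicInterval (d * n) k) :
    hilbertCurve d x ∈ dyadicCube n (cell d n k).pos := by
  obtain ⟨h1, h2⟩ := hx
  have hn0 : (0 : ℝ) < 2 ^ (d * n) := by positivity
  rw [div_le_iff₀ hn0] at h1
  rw [le_div_iff₀ hn0] at h2
  by_cases hidx : cellIndex d n x = k
  · rw [← hidx]; exact hilbertCurve_mem n x
  have hx0 : 0 ≤ x * 2 ^ (d * n) := le_trans (by positivity) h1
  have hf1 : k ≤ ⌊x * 2 ^ (d * n)⌋₊ := Nat.le_floor h1
  have hf2 : ⌊x * 2 ^ (d * n)⌋₊ ≤ k + 1 := by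
    have := Nat.floor_le hx0
    have h3 : ((⌊x * 2 ^ (d * n)⌋₊ : ℕ) : ℝ) ≤ ((k + 1 : ℕ) : ℝ) := by push_cast; linarith
    exact_mod_cast h3
  have hf : ⌊x * 2 ^ (d * n)⌋₊ = k + 1 ∧ k + 1 < 2 ^ (d * n) := by
    rw [cellIndex] at hidx; omega
  have hxe : x * 2 ^ (d * n) = (k : ℝ) + 1 := by
    apply le_antisymm h2
    have := Nat.floor_le hx0
    rw [hf.1] at this; push_cast at this; exact this
  -- on every finer level the cell of `x` is linked to a descendant of the given cell
  have hnear : ∀ r j, ∃ z ∈ dyadicCube n (cell d n k).pos,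
      |hilbertCurve d x j - z j| ≤ 2 / 2 ^ (n + r) := by
    intro r j
    have hr : 0 < 2 ^ (d * r) := by positivity
    have hpow : 2 ^ (d * (n + r)) = 2 ^ (d * n) * 2 ^ (d * r) := by rw [mul_add, pow_add]
    have hi : cellIndex d (n + r) x = (k + 1) * 2 ^ (d * r) := by
      have h4 : x * 2 ^ (d * (n + r)) = (((k + 1) * 2 ^ (d * r) : ℕ) : ℝ) := by
        rw [mul_add, pow_add, ← mul_assoc, hxe]; push_cast; ring
      rw [cellIndex, h4, Nat.floor_natCast, hpow]
      have : (k + 1 + 1) * 2 ^ (d * r) ≤ 2 ^ (d * n) * 2 ^ (d * r) :=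
        Nat.mul_le_mul_right _ hf.2
      rw [add_mul (k + 1)] at this
      omega
    have hge : 1 ≤ (k + 1) * 2 ^ (d * r) := Nat.mul_pos (by omega) hr
    set q := (k + 1) * 2 ^ (d * r) - 1 with hq
    have hq1 : q + 1 = (k + 1) * 2 ^ (d * r) := by omega
    have hqd : q / 2 ^ (d * r) = k := by
      apply Nat.div_eq_of_lt_le
      · have : (k + 1) * 2 ^ (d * r) = k * 2 ^ (d * r) + 2 ^ (d * r) := by ring
        omega
      · omega
    have hlink := cell_linked (d := d) (n + r) q (by
      rw [hq1, hpow]; exact Nat.mul_lt_mul_of_pos_right hf.2 hr)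
    have hzmem := dyadicCube_desc (d := d) n r q (corner_mem _ _)
    rw [hqd] at hzmem
    refine ⟨_, hzmem, ?_⟩
    have hH := hilbertCurve_mem (d := d) (n + r) x j
    rw [hi, ← hq1] at hH
    change |_ - ((cell d (n + r) q).pos j : ℝ) / 2 ^ (n + r)| ≤ _
    have hdiff : |((cell d (n + r) (q + 1)).pos j : ℝ) - (cell d (n + r) q).pos j| ≤ 1 := by
      obtain ⟨g, hg, hng⟩ := hlink
      by_cases hj : j = g
      · subst hj
        rcases hg with ⟨h, -⟩ | ⟨h, -⟩ <;> rw [h] <;> push_cast <;> simp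
      · rw [(hng j hj).1]; simp
    obtain ⟨ha, hb⟩ := hH
    have h2p : (0 : ℝ) < 2 ^ (n + r) := by positivity
    rw [div_le_iff₀ h2p] at ha
    rw [le_div_iff₀ h2p] at hb
    rw [abs_le] at hdiff
    rw [abs_le, neg_le_sub_iff_le_add, div_le_iff₀ h2p, add_mul, div_mul_cancel₀ _ h2p.ne',
      sub_le_iff_le_add, ← add_div, le_div_iff₀ h2p]
    constructor <;> linarith
  have hlim : Filter.Tendsto (fun r : ℕ => (2 : ℝ) / 2 ^ (n + r)) Filter.atTop (nhds 0) := by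
    have h := (tendsto_pow_atTop_nhds_zero_of_lt_one (r := (1 / 2 : ℝ)) (by norm_num)
      (by norm_num)).const_mul (2 / 2 ^ n)
    rw [mul_zero] at h
    refine h.congr fun r => ?_
    rw [pow_add, one_div, inv_pow]; field_simp
  intro j
  constructor
  · refine ge_of_tendsto' (x := Filter.atTop)
      (f := fun r : ℕ => hilbertCurve d x j + 2 / 2 ^ (n + r)) ?_ ?_
    · simpa using hlim.const_add (hilbertCurve d x j)
    · intro r
      obtain ⟨z, hz, hd⟩ := hnear r j
      have := (hz j).1
      rw [abs_le] at hd
      linarith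
  · refine le_of_tendsto' (x := Filter.atTop)
      (f := fun r : ℕ => hilbertCurve d x j - 2 / 2 ^ (n + r)) ?_ ?_
    · simpa using hlim.const_sub (hilbertCurve d x j)
    · intro r
      obtain ⟨z, hz, hd⟩ := hnear r j
      have := (hz j).2
      rw [abs_le] at hd
      linarith

lemma exists_child (c : Cell d) (n : ℕ) (y : EuclideanSpace ℝ (Fin d))
    (hy : y ∈ dyadicCube n c.pos) :
    ∃ l < 2 ^ d, y ∈ dyadicCube (n + 1) (c.child l).pos := by
  let F : Fin (2 ^ d) → (Fin d → Bool) :=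
    fun l j => xor (c.entry j) (gray l (j - c.shift : Fin d))
  have hF : Function.Bijective F := by
    rw [Fintype.bijective_iff_injective_and_card]
    refine ⟨fun l l' h => ?_, by simp⟩
    apply Fin.ext
    apply child_pos_inj (c := c) l.isLt l'.isLt
    funext j
    have := congrFun h j
    simp only [F] at this
    simp only [Cell.child, this]
  obtain ⟨l, hl⟩ := hF.2 fun j => decide ((2 * (c.pos j : ℝ) + 1) / 2 ^ (n + 1) ≤ y j)
  refine ⟨l, l.isLt, fun j => ?_⟩
  have h1 := congrFun hl j
  simp only [F] at h1
  simp only [Cell.child, h1]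
  obtain ⟨ha, hb⟩ := hy j
  have e1 : (c.pos j : ℝ) / 2 ^ n = (2 * (c.pos j : ℝ)) / 2 ^ (n + 1) := by
    rw [pow_succ]; field_simp
  have e2 : ((c.pos j : ℝ) + 1) / 2 ^ n = (2 * (c.pos j : ℝ) + 1 + 1) / 2 ^ (n + 1) := by
    rw [pow_succ]; field_simp; ring
  by_cases h : (2 * (c.pos j : ℝ) + 1) / 2 ^ (n + 1) ≤ y j
  · simp only [h, decide_true, Bool.toNat_true]; push_cast
    exact ⟨h, by rw [← e2]; exact hb⟩
  · simp only [h, decide_false, Bool.toNat_false]; push_cast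
    rw [add_zero]
    exact ⟨by rw [← e1]; exact ha, (not_le.1 h).le⟩

lemma hilbertCurve_surj (n k : ℕ) (hk : k < 2 ^ (d * n)) (y : EuclideanSpace ℝ (Fin d))
    (hy : y ∈ dyadicCube n (cell d n k).pos) :
    ∃ x ∈ dyadicInterval (d * n) k, hilbertCurve d x = y := by
  have hpd : 0 < 2 ^ d := by positivity
  let S : ℕ → Type := fun r =>
    {q : ℕ // q < 2 ^ (d * (n + r)) ∧ y ∈ dyadicCube (n + r) (cell d (n + r) q).pos}
  have step : ∀ r (s : S r), ∃ s' : S (r + 1), s'.1 / 2 ^ d = s.1 := by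
    rintro r ⟨q, hq, hyq⟩
    obtain ⟨l, hl, hyl⟩ := exists_child _ _ y hyq
    have h1 : (2 ^ d * q + l) / 2 ^ d = q := by
      rw [Nat.mul_add_div hpd, Nat.div_eq_of_lt hl, add_zero]
    have h2 : (2 ^ d * q + l) % 2 ^ d = l := by
      rw [Nat.mul_add_mod, Nat.mod_eq_of_lt hl]
    refine ⟨⟨2 ^ d * q + l, ?_, ?_⟩, h1⟩
    · rw [← add_assoc, show d * (n + r + 1) = d + d * (n + r) by ring, pow_add]
      calc 2 ^ d * q + l < 2 ^ d * q + 2 ^ d := by omega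
        _ = 2 ^ d * (q + 1) := by ring
        _ ≤ _ := Nat.mul_le_mul_left _ hq
    · change y ∈ dyadicCube (n + r + 1) (cell d (n + r + 1) _).pos
      simp only [cell]
      rw [h1, h2]; exact hyl
  choose nxt hnxt using step
  let s : ∀ r, S r := fun r => Nat.rec (⟨k, hk, hy⟩ : S 0) (fun r s => nxt r s) r
  have hs0 : (s 0).1 = k := rfl
  have hsr : ∀ r, (s (r + 1)).1 / 2 ^ d = (s r).1 := fun r => hnxt r (s r)
  have hsub : ∀ r, dyadicInterval (d * (n + (r + 1))) (s (r + 1)).1 ⊆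
      dyadicInterval (d * (n + r)) (s r).1 := by
    intro r
    have hdm := Nat.div_add_mod (s (r + 1)).1 (2 ^ d)
    have hlt := Nat.mod_lt (s (r + 1)).1 hpd
    rw [hsr] at hdm
    have hp : (2 : ℝ) ^ (d * (n + (r + 1))) = 2 ^ (d * (n + r)) * 2 ^ d := by
      rw [← pow_add]; congr 1
    have hpos : (0 : ℝ) < 2 ^ (d * (n + r)) := by positivity
    have hlo : (2 : ℝ) ^ d * (s r).1 ≤ (s (r + 1)).1 := by
      have : 2 ^ d * (s r).1 ≤ (s (r + 1)).1 := by omega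
      exact_mod_cast this
    have hhi : ((s (r + 1)).1 : ℝ) + 1 ≤ 2 ^ d * ((s r).1 + 1) := by
      have : (s (r + 1)).1 + 1 ≤ 2 ^ d * ((s r).1 + 1) := by
        have h3 := Nat.mul_add (2 ^ d) (s r).1 1
        omega
      exact_mod_cast this
    rw [dyadicInterval, dyadicInterval, hp]
    apply Set.Icc_subset_Icc
    · rw [div_le_div_iff₀ hpos (by positivity)]
      nlinarith
    · rw [div_le_div_iff₀ (by positivity) hpos]
      nlinarith
  obtain ⟨x, hx⟩ : (⋂ r, dyadicInterval (d * (n + r)) (s r).1).Nonempty := by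
    apply IsCompact.nonempty_iInter_of_sequence_nonempty_isCompact_isClosed _ hsub
    · intro r
      apply Set.nonempty_Icc.2
      gcongr; linarith
    · exact isCompact_Icc
    · intro r; exact isClosed_Icc
  rw [Set.mem_iInter] at hx
  refine ⟨x, hx 0, ?_⟩
  have hlim : Filter.Tendsto (fun r : ℕ => (1 : ℝ) / 2 ^ (n + r)) Filter.atTop (nhds 0) := by
    have h := (tendsto_pow_atTop_nhds_zero_of_lt_one (r := (1 / 2 : ℝ)) (by norm_num)
      (by norm_num)).const_mul (1 / 2 ^ n)
    rw [mul_zero] at h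
    refine h.congr fun r => ?_
    rw [pow_add, one_div, one_div, one_div, inv_pow, mul_inv]
  ext j
  have hle : |hilbertCurve d x j - y j| ≤ 0 := by
    refine ge_of_tendsto' hlim fun r => ?_
    have h1 := hilbertCurve_mem_of_mem (n + r) _ (s r).2.1 x (hx r) j
    have h2 := (s r).2.2 j
    rw [add_div] at h1 h2
    rw [abs_le]; constructor <;> linarith [h1.1, h1.2, h2.1, h2.2]
  have := abs_nonpos_iff.1 hle
  linarith

/-- Hilbert curves exist in every dimension. -/
theorem isHilbertCurve_hilbertCurve (d : ℕ) [NeZero d] : IsHilbertCurve (hilbertCurve d) := by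
  intro n
  refine ⟨fun k => (cell d n k).pos, fun k _ j => cell_pos_lt n k j, cell_injOn n, ?_, ?_⟩
  · intro k hk
    obtain ⟨g, hg, hi⟩ := cell_linked n k hk
    refine ⟨g, ?_, fun i hne => (hi i hne).1⟩
    rcases hg with h | h
    · exact Or.inl h.1
    · exact Or.inr h.1
  · intro k hk
    ext y
    constructor
    · rintro ⟨x, hx, rfl⟩
      exact hilbertCurve_mem_of_mem n k hk x hx
    · intro hy
      exact hilbertCurve_surj n k hk y hy

end Existence

end HSFC

end

/-!
The squared worst-case error of a point set is controlled by the `L²`-norm of its discrepancy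
function `D`. Indeed, a function `f` in the Sobolev space is recovered from its weak mixed
derivative `g` by `f x = (-1)^d ∫ g(t) 1[x < t] dt` (`MemH1.eq_integral`; test the defining identity
of `g` with smooth approximations of the indicator of the box between `x` and `(1, …, 1)`, and use
that `f` vanishes on the faces through `(1, …, 1)`). Hence the quadrature error of `f` equals
`(-1)^d ∫ g D`, and the Cauchy–Schwarz inequality gives `sqWorstCaseError_le`. Measurability of the
worst-case error holds because it is a supremum of continuous functions of the points.

The mean of `D(t)²` is computed for each corner `t` separately. In both sampling schemes every
stratum `E_s` receives exactly one point, uniformly distributed in `E_s` and independent of the other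
points and of the assignment of points to strata (`IsStratifiedSample`). The centred indicators
`1[X_i < t] - p_{σ i}`, where `p_s = N λ(E_s ∩ [0, t))`, are therefore uncorrelated, and
`E D(t)² = N⁻² ∑ p_s (1 - p_s)`. Only strata meeting both the box and its complement contribute, each
at most `1/4`. Since a Hilbert curve is Hölder continuous (`IsHilbertCurve.holder`), each coordinate
varies by at most `4 N^(-1/d)` on a stratum, so all these strata lie in `d` slabs of width
`8 N^(-1/d)`; comparing volumes, there are at most `8 d N^(1 - 1/d)` of them. This gives the bound
`2 d N^(-1 - 1/d)`, which is stronger than required.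

That the strata have volume `1/N` and overlap in null sets, and that uniform parameters yield uniform
points, follows from two properties of a Hilbert curve: it transports Lebesgue measure on `[0,1]` to
Lebesgue measure on the cube (`IsHilbertCurve.map_volume`), and it is injective above the points
without dyadic coordinates (`IsHilbertCurve.eq_of_eq`). For the scrambled points, the first `m` digits
run through all words of length `m` and select the strata, while the remaining digits are independent
and uniform and involve permutations that no other point uses.
-/

namespace HSFC

/-! ### The unit cube and its boxes -/

section Cube

variable {d : ℕ}

lemma setOf_box_eq_preimage (a b : Fin d → ℝ) :
    {x : EuclideanSpace ℝ (Fin d) | ∀ j, a j ≤ x j ∧ x j ≤ b j} =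
      WithLp.ofLp ⁻¹' Set.Icc a b := by
  ext x
  simp only [Set.mem_ofPred_eq, Set.mem_preimage, Set.mem_Icc, Pi.le_def]
  exact forall_and

lemma isClosed_box (a b : Fin d → ℝ) :
    IsClosed {x : EuclideanSpace ℝ (Fin d) | ∀ j, a j ≤ x j ∧ x j ≤ b j} := by
  rw [setOf_box_eq_preimage]
  exact isClosed_Icc.preimage (PiLp.continuous_ofLp 2 _)

lemma volume_box (a b : Fin d → ℝ) :
    volume {x : EuclideanSpace ℝ (Fin d) | ∀ j, a j ≤ x j ∧ x j ≤ b j} =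
      ∏ j, ENNReal.ofReal (b j - a j) := by
  rw [setOf_box_eq_preimage,
    (PiLp.volume_preserving_ofLp (Fin d)).measure_preimage measurableSet_Icc.nullMeasurableSet,
    Real.volume_Icc_pi]

lemma isClosed_unitCube : IsClosed (unitCube d) := isClosed_box 0 1

lemma measurableSet_unitCube : MeasurableSet (unitCube d) := isClosed_unitCube.measurableSet

lemma isCompact_unitCube : IsCompact (unitCube d) := by
  have h : unitCube d = WithLp.toLp 2 '' Set.Icc (0 : Fin d → ℝ) 1 := by
    rw [unitCube]
    refine (setOf_box_eq_preimage (0 : Fin d → ℝ) 1).trans ?_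
    ext x
    constructor
    · intro hx
      exact ⟨WithLp.ofLp x, hx, rfl⟩
    · rintro ⟨y, hy, rfl⟩
      exact hy
  rw [h]
  exact isCompact_Icc.image (PiLp.continuous_toLp 2 _)

lemma volume_unitCube : volume (unitCube d) = 1 := by
  rw [unitCube]
  refine (volume_box (0 : Fin d → ℝ) 1).trans ?_
  simp

instance : IsProbabilityMeasure (cubeMeasure d) :=
  ⟨by rw [cubeMeasure, Measure.restrict_apply_univ, volume_unitCube]⟩

lemma ae_mem_unitCube : ∀ᵐ x ∂(cubeMeasure d), x ∈ unitCube d :=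
  ae_restrict_mem measurableSet_unitCube

lemma volume_coord_eq (j : Fin d) (c : ℝ) :
    volume {x : EuclideanSpace ℝ (Fin d) | x j = c} = 0 := by
  have h := (PiLp.volume_preserving_ofLp (Fin d)).measure_preimage
    (s := {x : Fin d → ℝ | x j = c}) (measurableSet_eq_fun (measurable_pi_apply j)
      measurable_const).nullMeasurableSet
  refine h.trans ?_
  exact Measure.pi_hyperplane (fun _ : Fin d => (volume : Measure ℝ)) j c

lemma volume_slab_le (j : Fin d) (a b : ℝ) :
    volume {x ∈ unitCube d | a ≤ x j ∧ x j ≤ b} ≤ ENNReal.ofReal (b - a) := by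
  have hsub : {x ∈ unitCube d | a ≤ x j ∧ x j ≤ b} ⊆
      {x | ∀ i, Function.update (0 : Fin d → ℝ) j a i ≤ x i ∧
        x i ≤ Function.update (1 : Fin d → ℝ) j b i} := by
    rintro x ⟨hx, hxj⟩ i
    by_cases hi : i = j
    · subst hi; simpa using hxj
    · simpa [hi] using hx i
  refine (measure_mono hsub).trans ?_
  rw [volume_box, Finset.prod_eq_single j]
  · simp
  · intro i _ hi; simp [hi]
  · simp

lemma isClosed_dyadicCube (n : ℕ) (p : Fin d → ℕ) : IsClosed (dyadicCube n p) :=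
  isClosed_box _ _

lemma volume_dyadicCube (n : ℕ) (p : Fin d → ℕ) :
    volume (dyadicCube n p) = ENNReal.ofReal (1 / 2 ^ (d * n)) := by
  refine (volume_box _ _).trans ?_
  have : ∀ j, ((p j : ℝ) + 1) / 2 ^ n - (p j : ℝ) / 2 ^ n = 1 / 2 ^ n := fun j => by ring
  simp only [this]
  rw [Finset.prod_const, Finset.card_univ, Fintype.card_fin, ← ENNReal.ofReal_pow (by positivity),
    div_pow, one_pow, ← pow_mul, mul_comm n d]

lemma dyadicCube_subset_unitCube {n : ℕ} {p : Fin d → ℕ} (hp : ∀ j, p j < 2 ^ n) :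
    dyadicCube n p ⊆ unitCube d := by
  intro x hx j
  obtain ⟨h1, h2⟩ := hx j
  refine ⟨le_trans (by positivity) h1, h2.trans ?_⟩
  rw [div_le_one (by positivity)]
  have h : (p j : ℝ) + 1 ≤ 2 ^ n := by exact_mod_cast hp j
  exact h

lemma dist_le_sqrt_mul {x y : EuclideanSpace ℝ (Fin d)} {r : ℝ} (hr : 0 ≤ r)
    (h : ∀ j, |x j - y j| ≤ r) : dist x y ≤ √d * r := by
  rw [EuclideanSpace.dist_eq]
  have hj : ∀ j, dist (x j) (y j) ^ 2 ≤ r ^ 2 := fun j => by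
    have := h j
    rw [Real.dist_eq]
    gcongr
  calc √(∑ j, dist (x j) (y j) ^ 2) ≤ √(∑ _j : Fin d, r ^ 2) :=
        Real.sqrt_le_sqrt (Finset.sum_le_sum fun j _ => hj j)
    _ = √d * r := by
        rw [Finset.sum_const, Finset.card_univ, Fintype.card_fin, nsmul_eq_mul,
          Real.sqrt_mul (by positivity), Real.sqrt_sq hr]

/-- The points with a dyadic rational coordinate: these are the points that can lie in two
different dyadic cubes of one level. -/
def dyadicGrid (d : ℕ) : Set (EuclideanSpace ℝ (Fin d)) :=
  {x | ∃ (j : Fin d) (n k : ℕ), x j = (k : ℝ) / 2 ^ n}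

lemma dyadicGrid_eq_iUnion :
    dyadicGrid d = ⋃ (j : Fin d) (n : ℕ) (k : ℕ), {x | x j = (k : ℝ) / 2 ^ n} := by
  ext x; simp [dyadicGrid]

lemma volume_dyadicGrid : volume (dyadicGrid d) = 0 := by
  rw [dyadicGrid_eq_iUnion]
  simp only [measure_iUnion_null_iff]
  exact fun j n k => volume_coord_eq j _

lemma dyadicCube_inter_subset {n : ℕ} {p q : Fin d → ℕ} (h : p ≠ q) :
    dyadicCube n p ∩ dyadicCube n q ⊆ dyadicGrid d := by
  rintro x ⟨hp, hq⟩
  obtain ⟨j, hj⟩ := Function.ne_iff.1 h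
  have h2 : (0 : ℝ) < 2 ^ n := by positivity
  obtain ⟨a1, a2⟩ := hp j
  obtain ⟨b1, b2⟩ := hq j
  rcases lt_or_gt_of_ne hj with hlt | hlt
  · refine ⟨j, n, q j, le_antisymm (a2.trans ?_) b1⟩
    gcongr; exact_mod_cast hlt
  · refine ⟨j, n, p j, le_antisymm (b2.trans ?_) a1⟩
    gcongr; exact_mod_cast hlt

end Cube

/-! ### Identifying image measures by means of fine partitions -/

/-- A one-sided comparison on closed sets suffices: passing to complements reverses the inequality on
open sets, and a closed set is the limit of its open thickenings. -/
lemma measure_eq_of_le_isClosed {E : Type*} [PseudoEMetricSpace E] [MeasurableSpace E]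
    [BorelSpace E] (μ ν : Measure E) [IsProbabilityMeasure μ] [IsProbabilityMeasure ν]
    (h : ∀ F : Set E, IsClosed F → μ F ≤ ν F) : μ = ν := by
  have hopen : ∀ G : Set E, IsOpen G → ν G ≤ μ G := by
    intro G hG
    have h1 := h Gᶜ hG.isClosed_compl
    rw [prob_compl_eq_one_sub hG.measurableSet, prob_compl_eq_one_sub hG.measurableSet] at h1
    exact (ENNReal.sub_le_sub_iff_left prob_le_one ENNReal.one_ne_top).1 h1
  have hclosed : ∀ F : Set E, IsClosed F → μ F = ν F := by
    intro F hF
    refine le_antisymm (h F hF) ?_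
    exact le_of_tendsto_of_tendsto
      (tendsto_measure_thickening_of_isClosed ⟨1, one_pos, measure_ne_top _ _⟩ hF)
      (tendsto_measure_thickening_of_isClosed ⟨1, one_pos, measure_ne_top _ _⟩ hF)
      (Filter.Eventually.of_forall fun r => hopen _ Metric.isOpen_thickening)
  refine ext_of_generate_finite {s | IsClosed s} ?_ isPiSystem_isClosed
    (fun s hs => hclosed s hs) (by simp)
  rw [BorelSpace.measurable_eq (α := E), borel_eq_generateFrom_isClosed]

/-- Two maps have the same law if, for every `ε`, their domains can be cut into corresponding cells
of equal measure such that the maps are `ε`-close on corresponding cells. -/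
lemma map_eq_map_of_cells {α β E : Type*} [MeasurableSpace α] [MeasurableSpace β]
    [PseudoMetricSpace E] [MeasurableSpace E] [BorelSpace E]
    {μ : Measure α} {ν : Measure β} [IsProbabilityMeasure μ] [IsProbabilityMeasure ν]
    {f : α → E} {g : β → E} (hf : AEMeasurable f μ) (hg : AEMeasurable g ν)
    (h : ∀ ε > 0, ∃ (ι : Type) (s : Finset ι) (A : ι → Set α) (B : ι → Set β),
      (∀ᵐ x ∂μ, ∃ k ∈ s, x ∈ A k) ∧ (∀ k ∈ s, NullMeasurableSet (B k) ν) ∧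
      (s : Set ι).Pairwise (Function.onFun (AEDisjoint ν) B) ∧ (∀ k ∈ s, μ (A k) ≤ ν (B k)) ∧
      ∀ k ∈ s, ∀ x ∈ A k, ∀ y ∈ B k, dist (f x) (g y) ≤ ε) :
    μ.map f = ν.map g := by
  have := Measure.isProbabilityMeasure_map hf
  have := Measure.isProbabilityMeasure_map hg
  refine measure_eq_of_le_isClosed _ _ fun F hF => ?_
  have key : ∀ ε > 0, μ.map f F ≤ ν.map g (Metric.cthickening ε F) := by
    intro ε hε
    classical
    obtain ⟨ι, s, A, B, hA, hBm, hBd, hAB, hfg⟩ := h ε hε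
    rw [Measure.map_apply_of_aemeasurable hf hF.measurableSet,
      Measure.map_apply_of_aemeasurable hg Metric.isClosed_cthickening.measurableSet]
    set t := s.filter fun k => (A k ∩ f ⁻¹' F).Nonempty with ht
    have hts : t ⊆ s := Finset.filter_subset _ _
    calc μ (f ⁻¹' F) ≤ μ (⋃ k ∈ t, A k) := by
          refine measure_mono_ae ?_
          filter_upwards [hA] with x ⟨k, hk, hxk⟩ hx
          exact Set.mem_iUnion₂.2 ⟨k, Finset.mem_filter.2 ⟨hk, x, hxk, hx⟩, hxk⟩
      _ ≤ ∑ k ∈ t, μ (A k) := measure_biUnion_finset_le _ _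
      _ ≤ ∑ k ∈ t, ν (B k) := Finset.sum_le_sum fun k hk => hAB k (hts hk)
      _ = ν (⋃ k ∈ t, B k) := (measure_biUnion_finset₀
          (hBd.mono (Finset.coe_subset.2 hts)) fun k hk => hBm k (hts hk)).symm
      _ ≤ ν (g ⁻¹' Metric.cthickening ε F) := by
          refine measure_mono (Set.iUnion₂_subset fun k hk y hy => ?_)
          obtain ⟨hks, x, hxA, hxF⟩ := Finset.mem_filter.1 hk
          exact Metric.mem_cthickening_of_dist_le _ _ _ _ hxF
            (by rw [dist_comm]; exact hfg k hks x hxA y hy)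
  have hlim := tendsto_measure_cthickening_of_isClosed (μ := ν.map g) (s := F)
    ⟨1, one_pos, measure_ne_top _ _⟩ hF
  refine ge_of_tendsto (hlim.mono_left (nhdsWithin_le_nhds (s := Set.Ioi 0))) ?_
  filter_upwards [self_mem_nhdsWithin] with ε hε using key ε hε

/-! ### Regularity and measure preservation of Hilbert curves -/

lemma exists_mem_Icc_div {M : ℕ} (hM : 0 < M) {x : ℝ} (hx : x ∈ Set.Icc (0 : ℝ) 1) :
    ∃ k < M, (k : ℝ) / M ≤ x ∧ x ≤ ((k : ℝ) + 1) / M := by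
  have hM' : (0 : ℝ) < M := by exact_mod_cast hM
  by_cases h1 : x = 1
  · refine ⟨M - 1, by omega, ?_, ?_⟩
    · rw [h1, div_le_one hM']; exact_mod_cast Nat.sub_le M 1
    · rw [h1, Nat.cast_sub hM]; simp [hM'.ne']
  · have hx1 : x < 1 := lt_of_le_of_ne hx.2 h1
    have h0 : 0 ≤ x * M := mul_nonneg hx.1 hM'.le
    refine ⟨⌊x * M⌋₊, ?_, ?_, ?_⟩
    · rw [Nat.floor_lt h0]; nlinarith
    · rw [div_le_iff₀ hM']; exact Nat.floor_le h0
    · rw [le_div_iff₀ hM']; exact (Nat.lt_floor_add_one _).le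

lemma subsingleton_Icc_div_inter {M : ℕ} (hM : 0 < M) {i j : ℕ} (hij : i ≠ j) :
    (Set.Icc ((i : ℝ) / M) (((i : ℝ) + 1) / M) ∩
      Set.Icc ((j : ℝ) / M) (((j : ℝ) + 1) / M)).Subsingleton := by
  have hM' : (0 : ℝ) < M := by exact_mod_cast hM
  rintro x ⟨⟨hx1, hx2⟩, hx3, hx4⟩ y ⟨⟨hy1, hy2⟩, hy3, hy4⟩
  rw [div_le_iff₀ hM'] at hx1 hx3 hy1 hy3
  rw [le_div_iff₀ hM'] at hx2 hx4 hy2 hy4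
  refine mul_right_cancel₀ hM'.ne' ?_
  rcases lt_or_gt_of_ne hij with hlt | hlt
  · have : (i : ℝ) + 1 ≤ j := by exact_mod_cast hlt
    linarith
  · have : (j : ℝ) + 1 ≤ i := by exact_mod_cast hlt
    linarith

section Curve

variable {d : ℕ} {H : ℝ → EuclideanSpace ℝ (Fin d)}

/-- Parameters at distance at most `2^(-dn)` lie in one interval of level `n` or in two neighbouring
ones, which are mapped to cubes with a common face. -/
lemma IsHilbertCurve.abs_sub_le (hH : IsHilbertCurve H) (n : ℕ) {x y : ℝ}
    (hx : x ∈ Set.Icc (0 : ℝ) 1) (hy : y ∈ Set.Icc (0 : ℝ) 1) (hxy : |x - y| ≤ 1 / 2 ^ (d * n))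
    (j : Fin d) : |H x j - H y j| ≤ 2 / 2 ^ n := by
  wlog hle : x ≤ y generalizing x y
  · rw [abs_sub_comm]
    exact this hy hx (by rwa [abs_sub_comm]) (le_of_not_ge hle)
  obtain ⟨p, -, -, hadj, himg⟩ := hH n
  obtain ⟨k, hk, hk1, hk2⟩ := exists_mem_Icc_div (M := 2 ^ (d * n)) (by positivity) hx
  push_cast at hk1 hk2
  have hM : (0 : ℝ) < 2 ^ (d * n) := by positivity
  have hmem : ∀ l < 2 ^ (d * n), ∀ z ∈ dyadicInterval (d * n) l, H z ∈ dyadicCube n (p l) :=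
    fun l hl z hz => himg l hl ▸ Set.mem_image_of_mem H hz
  have hxk := hmem k hk x ⟨hk1, hk2⟩ j
  have hyx : y - x ≤ 1 / 2 ^ (d * n) := by
    rw [abs_sub_comm] at hxy; exact (le_abs_self _).trans hxy
  have h2n : (0 : ℝ) < 2 ^ n := by positivity
  rw [div_le_iff₀ h2n, le_div_iff₀ h2n] at hxk
  rw [le_div_iff₀ h2n, ← abs_of_pos h2n, ← abs_mul, sub_mul, abs_le]
  by_cases hyk : y ≤ ((k : ℝ) + 1) / 2 ^ (d * n)
  · have hyk := hmem k hk y ⟨hk1.trans hle, hyk⟩ j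
    rw [div_le_iff₀ h2n, le_div_iff₀ h2n] at hyk
    constructor <;> linarith [hxk.1, hxk.2, hyk.1, hyk.2]
  · push Not at hyk
    -- then `y` lies in the interval following that of `x`
    have hk' : k + 1 < 2 ^ (d * n) := by
      have h1 := hyk.trans_le hy.2
      rw [div_lt_one hM] at h1
      exact_mod_cast h1
    have hyk := hmem (k + 1) hk' y ⟨by push_cast; exact hyk.le, by
      push_cast
      calc y ≤ x + 1 / 2 ^ (d * n) := by linarith
        _ ≤ ((k : ℝ) + 1) / 2 ^ (d * n) + 1 / 2 ^ (d * n) := by linarith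
        _ = ((k : ℝ) + 1 + 1) / 2 ^ (d * n) := by ring⟩ j
    rw [div_le_iff₀ h2n, le_div_iff₀ h2n] at hyk
    have hp : |(p k j : ℝ) - p (k + 1) j| ≤ 1 := by
      obtain ⟨g, hg, hi⟩ := hadj k hk'
      by_cases hjg : j = g
      · subst hjg
        rcases hg with h | h <;> rw [h] <;> push_cast <;> simp
      · rw [hi j hjg]; simp
    rw [abs_le] at hp
    constructor <;> linarith [hxk.1, hxk.2, hyk.1, hyk.2]

/-- A Hilbert curve is Hölder continuous of exponent `1/d`. -/
lemma IsHilbertCurve.holder (hH : IsHilbertCurve H) {x y : ℝ} (hx : x ∈ Set.Icc (0 : ℝ) 1)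
    (hy : y ∈ Set.Icc (0 : ℝ) 1) (j : Fin d) :
    |H x j - H y j| ≤ 4 * |x - y| ^ (1 / (d : ℝ)) := by
  have hd : 0 < d := j.pos
  by_cases hxy : x = y
  · subst hxy; simp only [sub_self, abs_zero]; positivity
  have hpos : 0 < |x - y| := abs_pos.2 (sub_ne_zero.2 hxy)
  have hle : |x - y| ≤ 1 := abs_le.2 ⟨by linarith [hx.1, hy.2], by linarith [hx.2, hy.1]⟩
  obtain ⟨n, hn1, hn2⟩ := exists_nat_pow_near_of_lt_one (y := (1 / 2 : ℝ) ^ d) hpos hle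
    (by positivity) (pow_lt_one₀ (by norm_num) (by norm_num) hd.ne')
  refine (hH.abs_sub_le n hx hy (by rwa [← pow_mul, div_pow, one_pow] at hn2) j).trans ?_
  have h1 : ((1 / 2 : ℝ) ^ (n + 1)) ≤ |x - y| ^ (1 / (d : ℝ)) := by
    calc (1 / 2 : ℝ) ^ (n + 1) = (((1 / 2 : ℝ) ^ (n + 1)) ^ d) ^ (1 / (d : ℝ)) := by
          rw [one_div (d : ℝ), Real.pow_rpow_inv_natCast (by positivity) hd.ne']
      _ ≤ |x - y| ^ (1 / (d : ℝ)) := by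
          refine Real.rpow_le_rpow (by positivity) ?_ (by positivity)
          rw [← pow_mul, mul_comm, pow_mul]; exact hn1.le
  calc (2 : ℝ) / 2 ^ n = 4 * (1 / 2 : ℝ) ^ (n + 1) := by
        rw [pow_succ, div_pow, one_pow]; ring
    _ ≤ _ := by linarith

lemma exists_div_two_pow_lt (c : ℝ) {e : ℝ} (he : 0 < e) : ∃ n : ℕ, c / 2 ^ n < e := by
  have h := (tendsto_pow_atTop_nhds_zero_of_lt_one (r := (1 / 2 : ℝ)) (by norm_num)
      (by norm_num)).const_mul c
  rw [mul_zero] at h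
  obtain ⟨n, hn⟩ := (h.eventually_lt_const he).exists
  exact ⟨n, by rwa [div_pow, one_pow, mul_one_div] at hn⟩

lemma IsHilbertCurve.continuousOn (hH : IsHilbertCurve H) :
    ContinuousOn H (Set.Icc 0 1) := by
  have hj : ∀ j, ContinuousOn (fun x => H x j) (Set.Icc 0 1) := by
    intro j
    rw [Metric.continuousOn_iff]
    intro x hx e he
    obtain ⟨n, hn⟩ := exists_div_two_pow_lt 2 he
    refine ⟨1 / 2 ^ (d * n), by positivity, fun y hy hyx => ?_⟩
    exact (hH.abs_sub_le n hy hx hyx.le j).trans_lt hn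
  exact (PiLp.continuous_toLp 2 (fun _ : Fin d => ℝ)).comp_continuousOn
    (continuousOn_pi.2 hj)

lemma dist_le_of_mem_dyadicCube {n : ℕ} {p : Fin d → ℕ} {x y : EuclideanSpace ℝ (Fin d)}
    (hx : x ∈ dyadicCube n p) (hy : y ∈ dyadicCube n p) : dist x y ≤ √d / 2 ^ n := by
  rw [div_eq_mul_one_div]
  refine dist_le_sqrt_mul (by positivity) fun j => ?_
  obtain ⟨a, b⟩ := hx j
  obtain ⟨c, e⟩ := hy j
  rw [add_div] at b e
  rw [abs_le]
  constructor <;> linarith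

lemma IsHilbertCurve.mem_unitCube (hH : IsHilbertCurve H) {x : ℝ} (hx : x ∈ Set.Icc (0 : ℝ) 1) :
    H x ∈ unitCube d := by
  obtain ⟨p, hlt, -, -, himg⟩ := hH 0
  have h := himg 0 (by simp)
  have hx' : x ∈ dyadicInterval (d * 0) 0 := by simpa [dyadicInterval] using hx
  exact dyadicCube_subset_unitCube (hlt 0 (by simp)) (h ▸ Set.mem_image_of_mem H hx')

lemma IsHilbertCurve.image_Icc (hH : IsHilbertCurve H) :
    H '' Set.Icc 0 1 = unitCube d := by
  obtain ⟨p, hlt, -, -, himg⟩ := hH 0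
  have h := himg 0 (by simp)
  have hp : ∀ j, p 0 j = 0 := fun j => by simpa using hlt 0 (by simp) j
  simpa [dyadicInterval, dyadicCube, unitCube, hp] using h

instance : IsProbabilityMeasure ((volume : Measure ℝ).restrict (Set.Icc 0 1)) :=
  ⟨by simp⟩

lemma IsHilbertCurve.aemeasurable (hH : IsHilbertCurve H) :
    AEMeasurable H (volume.restrict (Set.Icc 0 1)) :=
  hH.continuousOn.aemeasurable measurableSet_Icc

/-- A Hilbert curve transports Lebesgue measure on `[0,1]` to Lebesgue measure on the cube. -/
lemma IsHilbertCurve.map_volume (hH : IsHilbertCurve H) :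
    (volume.restrict (Set.Icc 0 1)).map H = cubeMeasure d := by
  have key : (volume.restrict (Set.Icc 0 1)).map H = (cubeMeasure d).map id := by
    refine map_eq_map_of_cells hH.aemeasurable aemeasurable_id fun e he => ?_
    obtain ⟨n, hn⟩ := exists_div_two_pow_lt (√d) he
    obtain ⟨p, hlt, hinj, -, himg⟩ := hH n
    refine ⟨ℕ, Finset.range (2 ^ (d * n)), fun k => dyadicInterval (d * n) k,
      fun k => dyadicCube n (p k), ?_, ?_, ?_, ?_, ?_⟩
    · filter_upwards [ae_restrict_mem measurableSet_Icc] with x hx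
      obtain ⟨k, hk, hk1, hk2⟩ := exists_mem_Icc_div (M := 2 ^ (d * n)) (by positivity) hx
      exact ⟨k, Finset.mem_range.2 hk, by push_cast at hk1; exact hk1,
        by push_cast at hk2; exact hk2⟩
    · exact fun k _ => (isClosed_dyadicCube n _).measurableSet.nullMeasurableSet
    · intro k hk l hl hkl
      have hpkl : p k ≠ p l := fun h => hkl (hinj (by simpa using hk) (by simpa using hl) h)
      exact measure_mono_null (dyadicCube_inter_subset hpkl)
        (Measure.restrict_le_self.absolutelyContinuous volume_dyadicGrid)
    · intro k hk
      rw [cubeMeasure, Measure.restrict_eq_self _ (dyadicCube_subset_unitCube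
        (hlt k (Finset.mem_range.1 hk))), volume_dyadicCube]
      refine (Measure.restrict_apply_le _ _).trans ?_
      refine (Real.volume_Icc (a := (k : ℝ) / 2 ^ (d * n))
        (b := ((k : ℝ) + 1) / 2 ^ (d * n))).le.trans ?_
      rw [← sub_div, add_sub_cancel_left]
    · intro k hk x hx y hy
      exact (dist_le_of_mem_dyadicCube
        (himg k (Finset.mem_range.1 hk) ▸ Set.mem_image_of_mem H hx) hy).trans hn.le
  rwa [Measure.map_id] at key

/-- A Hilbert curve is injective above the points without dyadic coordinates: different parameters
lie in different intervals of a fine level, hence are mapped to different cubes. -/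
lemma IsHilbertCurve.eq_of_eq (hd : d ≠ 0) (hH : IsHilbertCurve H) {x y : ℝ}
    (hx : x ∈ Set.Icc (0 : ℝ) 1) (hy : y ∈ Set.Icc (0 : ℝ) 1) (hxy : H x = H y)
    (hg : H x ∉ dyadicGrid d) : x = y := by
  by_contra hne
  obtain ⟨n, hn⟩ := exists_div_two_pow_lt 1 (abs_pos.2 (sub_ne_zero.2 hne))
  have hn' : (1 : ℝ) / 2 ^ (d * n) < |x - y| := by
    refine lt_of_le_of_lt ?_ hn
    exact one_div_le_one_div_of_le (by positivity)
      (pow_le_pow_right₀ (by norm_num) (Nat.le_mul_of_pos_left _ (Nat.pos_of_ne_zero hd)))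
  obtain ⟨p, -, hinj, -, himg⟩ := hH n
  obtain ⟨k, hk, hk1, hk2⟩ := exists_mem_Icc_div (M := 2 ^ (d * n)) (by positivity) hx
  obtain ⟨l, hl, hl1, hl2⟩ := exists_mem_Icc_div (M := 2 ^ (d * n)) (by positivity) hy
  push_cast at hk1 hk2 hl1 hl2
  have hkl : k ≠ l := by
    rintro rfl
    refine absurd hn' (not_lt.2 ?_)
    rw [add_div] at hk2 hl2
    rw [abs_le]
    constructor <;> linarith
  have hpkl : p k ≠ p l := fun h => hkl (hinj hk hl h)
  apply hg
  refine dyadicCube_inter_subset (n := n) hpkl ⟨?_, ?_⟩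
  · rw [← himg k hk]
    exact Set.mem_image_of_mem H ⟨hk1, hk2⟩
  rw [hxy, ← himg l hl]
  exact Set.mem_image_of_mem H ⟨hl1, hl2⟩

lemma IsHilbertCurve.ae_mem_image_iff (hd : d ≠ 0) (hH : IsHilbertCurve H) {S : Set ℝ}
    (hS : S ⊆ Set.Icc 0 1) :
    ∀ᵐ x ∂(volume.restrict (Set.Icc (0 : ℝ) 1)), H x ∈ H '' S ↔ x ∈ S := by
  have hgrid : ∀ᵐ x ∂(volume.restrict (Set.Icc (0 : ℝ) 1)), H x ∉ dyadicGrid d := by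
    have h0 : cubeMeasure d (dyadicGrid d) = 0 :=
      Measure.restrict_le_self.absolutelyContinuous volume_dyadicGrid
    rw [← hH.map_volume] at h0
    exact ae_of_ae_map hH.aemeasurable (measure_eq_zero_iff_ae_notMem.1 h0)
  filter_upwards [hgrid, ae_restrict_mem measurableSet_Icc] with x hx hx01
  refine ⟨?_, fun h => Set.mem_image_of_mem H h⟩
  rintro ⟨y, hy, hyx⟩
  rwa [hH.eq_of_eq hd hx01 (hS hy) hyx.symm hx]

/-- A Hilbert curve transports Lebesgue measure on a subinterval to Lebesgue measure on its
image. -/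
lemma IsHilbertCurve.map_restrict_Icc (hd : d ≠ 0) (hH : IsHilbertCurve H) {a b : ℝ}
    (hab : Set.Icc a b ⊆ Set.Icc 0 1) :
    (volume.restrict (Set.Icc a b)).map H = volume.restrict (H '' Set.Icc a b) := by
  have hIm : volume.restrict (Set.Icc a b) =
      (volume.restrict (Set.Icc (0 : ℝ) 1)).restrict (Set.Icc a b) := by
    rw [Measure.restrict_restrict measurableSet_Icc, Set.inter_eq_left.2 hab]
  have hE : IsCompact (H '' Set.Icc a b) :=
    isCompact_Icc.image_of_continuousOn (hH.continuousOn.mono hab)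
  have hEc : H '' Set.Icc a b ⊆ unitCube d := by
    rintro _ ⟨x, hx, rfl⟩; exact hH.mem_unitCube (hab hx)
  ext B hB
  rw [Measure.map_apply_of_aemeasurable
      (hH.aemeasurable.mono_measure (Measure.restrict_mono_set _ hab)) hB,
    hIm, Measure.restrict_apply₀' measurableSet_Icc.nullMeasurableSet, Measure.restrict_apply hB,
    ← Measure.restrict_eq_self volume (Set.inter_subset_right.trans hEc)]
  change _ = cubeMeasure d _
  rw [← hH.map_volume, Measure.map_apply_of_aemeasurable hH.aemeasurable
    (hB.inter hE.measurableSet)]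
  refine measure_congr ?_
  filter_upwards [hH.ae_mem_image_iff hd hab] with x hx
  exact propext (and_congr Iff.rfl hx.symm)

lemma IsHilbertCurve.volume_image_Icc (hd : d ≠ 0) (hH : IsHilbertCurve H) {a b : ℝ}
    (hab : Set.Icc a b ⊆ Set.Icc 0 1) :
    volume (H '' Set.Icc a b) = ENNReal.ofReal (b - a) := by
  rw [← Measure.restrict_apply_univ, ← hH.map_restrict_Icc hd hab,
    Measure.map_apply_of_aemeasurable
      (hH.aemeasurable.mono_measure (Measure.restrict_mono_set _ hab)) MeasurableSet.univ]
  simp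

/-! ### The strata -/

variable {N : ℕ}

lemma Icc_div_subset (i : Fin N) :
    Set.Icc ((i : ℝ) / N) (((i : ℝ) + 1) / N) ⊆ Set.Icc 0 1 := by
  have hN : (0 : ℝ) < N := by exact_mod_cast i.pos
  have hi : ((i : ℕ) : ℝ) + 1 ≤ N := by exact_mod_cast i.isLt
  exact Set.Icc_subset_Icc (by positivity) ((div_le_one hN).2 hi)

lemma IsHilbertCurve.isCompact_stratum (hH : IsHilbertCurve H) (i : Fin N) :
    IsCompact (stratum H N i) :=
  isCompact_Icc.image_of_continuousOn (hH.continuousOn.mono (Icc_div_subset i))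

lemma IsHilbertCurve.stratum_subset (hH : IsHilbertCurve H) (i : Fin N) :
    stratum H N i ⊆ unitCube d := by
  rintro _ ⟨x, hx, rfl⟩; exact hH.mem_unitCube (Icc_div_subset i hx)

lemma IsHilbertCurve.iUnion_stratum (hH : IsHilbertCurve H) (hN : 0 < N) :
    (⋃ i : Fin N, stratum H N i) = unitCube d := by
  refine Set.Subset.antisymm (Set.iUnion_subset fun i => hH.stratum_subset i) fun y hy => ?_
  rw [← hH.image_Icc] at hy
  obtain ⟨x, hx, rfl⟩ := hy
  obtain ⟨k, hk, hk1, hk2⟩ := exists_mem_Icc_div hN hx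
  exact Set.mem_iUnion.2 ⟨⟨k, hk⟩, Set.mem_image_of_mem H ⟨hk1, hk2⟩⟩

lemma IsHilbertCurve.volume_stratum (hd : d ≠ 0) (hH : IsHilbertCurve H) (i : Fin N) :
    volume (stratum H N i) = (N : ℝ≥0∞)⁻¹ := by
  have hN : (0 : ℝ) < N := by exact_mod_cast i.pos
  rw [stratum, hH.volume_image_Icc hd (Icc_div_subset i), ← sub_div, add_sub_cancel_left,
    one_div, ENNReal.ofReal_inv_of_pos hN, ENNReal.ofReal_natCast]

lemma IsHilbertCurve.aedisjoint_stratum (hd : d ≠ 0) (hH : IsHilbertCurve H) :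
    Pairwise fun i j : Fin N => AEDisjoint volume (stratum H N i) (stratum H N j) := by
  intro i j hij
  have h := congrArg (fun μ => μ (stratum H N j)) (hH.map_restrict_Icc hd (Icc_div_subset i))
  rw [Measure.restrict_apply (hH.isCompact_stratum j).measurableSet, Set.inter_comm,
    Measure.map_apply_of_aemeasurable (hH.aemeasurable.mono_measure
      (Measure.restrict_mono_set _ (Icc_div_subset i))) (hH.isCompact_stratum j).measurableSet] at h
  rw [AEDisjoint, stratum, ← h]
  have hsub := subsingleton_Icc_div_inter i.pos (Fin.val_ne_of_ne hij.symm)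
  refine measure_mono_null_ae ?_ ((Measure.restrict_apply_le _ _).trans_eq
    (hsub.measure_zero volume) |>.antisymm zero_le)
  filter_upwards [ae_restrict_mem measurableSet_Icc, ae_mono (Measure.restrict_mono_set volume
    (Icc_div_subset i)) (hH.ae_mem_image_iff hd (Icc_div_subset j))] with x hx hxj hxm
  exact ⟨hxj.1 hxm, hx⟩

lemma IsHilbertCurve.abs_sub_le_of_mem_stratum (hH : IsHilbertCurve H) {i : Fin N}
    {x y : EuclideanSpace ℝ (Fin d)} (hx : x ∈ stratum H N i) (hy : y ∈ stratum H N i)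
    (j : Fin d) : |x j - y j| ≤ 4 * (1 / (N : ℝ)) ^ (1 / (d : ℝ)) := by
  obtain ⟨u, hu, rfl⟩ := hx
  obtain ⟨v, hv, rfl⟩ := hy
  refine (hH.holder (Icc_div_subset i hu) (Icc_div_subset i hv) j).trans ?_
  have huv : |u - v| ≤ 1 / N := by
    obtain ⟨h1, h2⟩ := hu
    obtain ⟨h3, h4⟩ := hv
    rw [add_div] at h2 h4
    rw [abs_le]; constructor <;> linarith
  gcongr

end Curve

/-! ### Product functions on the cube -/

section Product

variable {d : ℕ}

lemma cubeMeasure_eq_map :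
    cubeMeasure d = (Measure.pi fun _ : Fin d => (volume : Measure ℝ).restrict (Set.Icc 0 1)).map
      (MeasurableEquiv.toLp 2 (Fin d → ℝ)) := by
  rw [← Measure.restrict_pi_pi, ← volume_pi, cubeMeasure]
  have h := (EuclideanSpace.volume_preserving_symm_measurableEquiv_toLp (Fin d)).symm
  rw [← h.map_eq]
  change ((volume.map (MeasurableEquiv.toLp 2 (Fin d → ℝ))).restrict (unitCube d)) = _
  rw [(MeasurableEquiv.toLp 2 (Fin d → ℝ)).restrict_map]
  congr 2
  ext x
  simp only [Set.mem_preimage, unitCube, Set.mem_ofPred_eq, Set.mem_pi, Set.mem_univ,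
    forall_true_left, Set.mem_Icc]
  rfl

lemma integral_cubeMeasure_prod (f : Fin d → ℝ → ℝ) :
    ∫ x, ∏ j, f j (x j) ∂(cubeMeasure d) = ∏ j, ∫ s in Set.Icc (0 : ℝ) 1, f j s := by
  rw [cubeMeasure_eq_map, MeasureTheory.integral_map_equiv]
  exact integral_fintype_prod_eq_prod (μ := fun _ => volume.restrict (Set.Icc 0 1)) f

lemma integrable_cubeMeasure_prod {f : Fin d → ℝ → ℝ}
    (hf : ∀ j, IntegrableOn (f j) (Set.Icc 0 1)) :
    Integrable (fun x : EuclideanSpace ℝ (Fin d) => ∏ j, f j (x j)) (cubeMeasure d) := by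
  rw [cubeMeasure_eq_map, MeasureTheory.integrable_map_equiv]
  exact Integrable.fintype_prod (μ := fun _ => volume.restrict (Set.Icc 0 1)) hf

lemma contDiff_prod_coord {h : Fin d → ℝ → ℝ} {n : WithTop ℕ∞} (hh : ∀ j, ContDiff ℝ n (h j)) :
    ContDiff ℝ n fun x : EuclideanSpace ℝ (Fin d) => ∏ j, h j (x j) :=
  contDiff_prod fun j _ => (hh j).comp (EuclideanSpace.proj (𝕜 := ℝ) j).contDiff

lemma fderiv_prod_coord_single {h : Fin d → ℝ → ℝ} (hh : ∀ j, Differentiable ℝ (h j))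
    (i : Fin d) (x : EuclideanSpace ℝ (Fin d)) :
    fderiv ℝ (fun y : EuclideanSpace ℝ (Fin d) => ∏ j, h j (y j)) x (EuclideanSpace.single i 1) =
      ∏ j, (if j = i then deriv (h j) else h j) (x j) := by
  have h1 : ∀ j ∈ Finset.univ, HasFDerivAt (fun y : EuclideanSpace ℝ (Fin d) => h j (y j))
      (deriv (h j) (x j) • (EuclideanSpace.proj (𝕜 := ℝ) j : EuclideanSpace ℝ (Fin d) →L[ℝ] ℝ)) x :=
    fun j _ => (hh j (x j)).hasDerivAt.comp_hasFDerivAt x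
      (EuclideanSpace.proj (𝕜 := ℝ) j : EuclideanSpace ℝ (Fin d) →L[ℝ] ℝ).hasFDerivAt
  rw [(HasFDerivAt.finsetProd h1).fderiv]
  simp only [sum_apply, smul_apply, smul_eq_mul]
  rw [Finset.sum_eq_single i]
  · rw [← Finset.prod_erase_mul _ _ (Finset.mem_univ i), if_pos rfl]
    congr 1
    · exact Finset.prod_congr rfl fun j hj => by rw [if_neg (Finset.ne_of_mem_erase hj)]
    · simp
  · intro j _ hj
    simp [hj]
  · simp

/-- Differentiating a product of functions of single coordinates along distinct axes differentiates
the corresponding factors once each. -/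
lemma iteratedFDeriv_prod_coord {h : Fin d → ℝ → ℝ}
    (hh : ∀ j, ContDiff ℝ ((⊤ : ℕ∞) : WithTop ℕ∞) (h j)) (k : ℕ) (v : Fin k → Fin d)
    (hv : Function.Injective v) (x : EuclideanSpace ℝ (Fin d)) :
    iteratedFDeriv ℝ k (fun y : EuclideanSpace ℝ (Fin d) => ∏ j, h j (y j)) x
        (fun i => EuclideanSpace.single (v i) 1) =
      ∏ j, (if ∃ i, v i = j then deriv (h j) else h j) (x j) := by
  induction k generalizing x with
  | zero => simp
  | succ k ih =>
    have hdiff := ((contDiff_prod_coord hh).differentiable_iteratedFDeriv (m := k)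
      (by exact_mod_cast ENat.natCast_lt_top k)) x
    rw [iteratedFDeriv_succ_apply_left]
    have happ := ((ContinuousMultilinearMap.apply ℝ (fun _ : Fin k => EuclideanSpace ℝ (Fin d)) ℝ
      (Fin.tail fun i => EuclideanSpace.single (v i) (1 : ℝ))).hasFDerivAt.comp x
      hdiff.hasFDerivAt).fderiv
    have hfun : (⇑(ContinuousMultilinearMap.apply ℝ (fun _ : Fin k => EuclideanSpace ℝ (Fin d)) ℝ
        (Fin.tail fun i => EuclideanSpace.single (v i) (1 : ℝ))) ∘
        iteratedFDeriv ℝ k fun y : EuclideanSpace ℝ (Fin d) => ∏ j, h j (y j)) =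
        fun y => ∏ j, (if ∃ i, Fin.tail v i = j then deriv (h j) else h j) (y j) := by
      funext y
      exact ih (Fin.tail v) (hv.comp (Fin.succ_injective k)) y
    rw [hfun] at happ
    have h2 := congrArg (fun L => L (EuclideanSpace.single (v 0) (1 : ℝ))) happ
    refine h2.symm.trans ?_
    have hder : ∀ j, Differentiable ℝ (deriv (h j)) := fun j =>
      ((contDiff_infty_iff_deriv.1 (hh j)).2).differentiable (by simp)
    refine (fderiv_prod_coord_single (fun j => ?_) (v 0) x).trans ?_
    · split_ifs
      · exact hder j
      · exact (hh j).differentiable (by simp)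
    · refine Finset.prod_congr rfl fun j _ => ?_
      by_cases hj : j = v 0
      · subst hj
        have h3 : ¬ ∃ i, Fin.tail v i = v 0 := by
          rintro ⟨i, hi⟩
          exact Fin.succ_ne_zero i (hv hi)
        have h4 : ∃ i, v i = v 0 := ⟨0, rfl⟩
        simp only [if_neg h3, if_pos h4, if_true]
      · have h3 : (∃ i, Fin.tail v i = j) ↔ ∃ i, v i = j := by
          constructor
          · rintro ⟨i, hi⟩; exact ⟨i.succ, hi⟩
          · rintro ⟨i, hi⟩
            obtain rfl | ⟨l, rfl⟩ := Fin.eq_zero_or_eq_succ i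
            · exact absurd hi.symm hj
            · exact ⟨l, hi⟩
        simp only [hj, if_false, h3]

lemma mixedPartial_prod_coord {h : Fin d → ℝ → ℝ}
    (hh : ∀ j, ContDiff ℝ ((⊤ : ℕ∞) : WithTop ℕ∞) (h j)) (x : EuclideanSpace ℝ (Fin d)) :
    mixedPartial (fun y => ∏ j, h j (y j)) x = ∏ j, deriv (h j) (x j) := by
  refine (iteratedFDeriv_prod_coord hh d id Function.injective_id x).trans ?_
  simp

end Product

/-! ### Smooth approximations of indicators of intervals -/

/-- A smooth function that rises from `0` to `1` on `[a, a + e]` and falls back to `0` on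
`[c, c + e]`. -/
noncomputable def smoothBump (a c e s : ℝ) : ℝ :=
  Real.smoothTransition ((s - a) / e) - Real.smoothTransition ((s - c) / e)

section Bump

variable {a c e s : ℝ}

lemma contDiff_smoothBump : ContDiff ℝ ((⊤ : ℕ∞) : WithTop ℕ∞) (smoothBump a c e) := by
  unfold smoothBump
  have h : ∀ b, ContDiff ℝ ((⊤ : ℕ∞) : WithTop ℕ∞)
      fun s => Real.smoothTransition ((s - b) / e) := fun b =>
    Real.smoothTransition.contDiff.comp ((contDiff_id.sub contDiff_const).div_const e)
  exact (h a).sub (h c)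

lemma abs_smoothBump_le : |smoothBump a c e s| ≤ 1 := by
  have h1 := Real.smoothTransition.nonneg ((s - a) / e)
  have h2 := Real.smoothTransition.le_one ((s - a) / e)
  have h3 := Real.smoothTransition.nonneg ((s - c) / e)
  have h4 := Real.smoothTransition.le_one ((s - c) / e)
  rw [smoothBump, abs_le]
  constructor <;> linarith

lemma smoothTransition_div_eq_zero {b : ℝ} (he : 0 < e) (h : s ≤ b) :
    Real.smoothTransition ((s - b) / e) = 0 :=
  Real.smoothTransition.zero_of_nonpos (div_nonpos_of_nonpos_of_nonneg (by linarith) he.le)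

lemma smoothTransition_div_eq_one {b : ℝ} (he : 0 < e) (h : b + e ≤ s) :
    Real.smoothTransition ((s - b) / e) = 1 :=
  Real.smoothTransition.one_of_one_le ((one_le_div he).2 (by linarith))

lemma smoothBump_eq_zero_of_le (he : 0 < e) (hac : a ≤ c) (h : s ≤ a) :
    smoothBump a c e s = 0 := by
  rw [smoothBump, smoothTransition_div_eq_zero he h, smoothTransition_div_eq_zero he (h.trans hac),
    sub_zero]

lemma smoothBump_eq_zero_of_ge (he : 0 < e) (hac : a ≤ c) (h : c + e ≤ s) :
    smoothBump a c e s = 0 := by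
  rw [smoothBump, smoothTransition_div_eq_one he h, smoothTransition_div_eq_one he (by linarith),
    sub_self]

lemma smoothBump_eq_one (he : 0 < e) (h1 : a + e ≤ s) (h2 : s ≤ c) :
    smoothBump a c e s = 1 := by
  rw [smoothBump, smoothTransition_div_eq_one he h1, smoothTransition_div_eq_zero he h2, sub_zero]

lemma tsupport_smoothBump_subset (he : 0 < e) (hac : a ≤ c) :
    tsupport (smoothBump a c e) ⊆ Set.Icc a (c + e) := by
  refine closure_minimal (fun s hs => ?_) isClosed_Icc
  by_contra h
  rw [Set.mem_Icc, not_and_or, not_le, not_le] at h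
  rcases h with h | h
  · exact hs (smoothBump_eq_zero_of_le he hac h.le)
  · exact hs (smoothBump_eq_zero_of_ge he hac h.le)

/-- The derivative of a bump vanishes off its two transition intervals. -/
lemma deriv_smoothBump_ne_zero (he : 0 < e) (hac : a ≤ c) (h : deriv (smoothBump a c e) s ≠ 0) :
    s ∈ Set.Icc a (a + e) ∨ s ∈ Set.Icc c (c + e) := by
  by_contra hs
  rw [not_or, Set.mem_Icc, Set.mem_Icc, not_and_or, not_and_or] at hs
  simp only [not_le] at hs
  obtain ⟨h1, h2⟩ := hs
  apply h
  have hconst : ∀ r : ℝ, smoothBump a c e =ᶠ[nhds s] (fun _ => r) →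
      deriv (smoothBump a c e) s = 0 := fun r hr => by rw [hr.deriv_eq, deriv_const]
  rcases h1 with h1 | h1
  · refine hconst 0 ?_
    filter_upwards [Iio_mem_nhds h1] with u hu using smoothBump_eq_zero_of_le he hac (le_of_lt hu)
  rcases h2 with h2 | h2
  · refine hconst 1 ?_
    filter_upwards [Ioo_mem_nhds h1 h2] with u hu using smoothBump_eq_one he hu.1.le hu.2.le
  · refine hconst 0 ?_
    filter_upwards [Ioi_mem_nhds h2] with u hu using smoothBump_eq_zero_of_ge he hac (le_of_lt hu)

lemma hasDerivAt_smoothBump : HasDerivAt (smoothBump a c e) (deriv (smoothBump a c e) s) s :=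
  ((contDiff_smoothBump.differentiable (by simp)) s).hasDerivAt

lemma continuous_deriv_smoothBump : Continuous (deriv (smoothBump a c e)) :=
  (contDiff_infty_iff_deriv.1 contDiff_smoothBump).2.continuous

lemma setIntegral_deriv_smoothBump {u v : ℝ} (huv : u ≤ v) :
    ∫ s in Set.Icc u v, deriv (smoothBump a c e) s =
      smoothBump a c e v - smoothBump a c e u := by
  rw [integral_Icc_eq_integral_Ioc, ← intervalIntegral.integral_of_le huv]
  exact intervalIntegral.integral_eq_sub_of_hasDerivAt (fun s _ => hasDerivAt_smoothBump)
    (continuous_deriv_smoothBump.intervalIntegrable _ _)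

lemma deriv_smoothBump_nonneg (he : 0 < e) (h : s < c) :
    0 ≤ deriv (smoothBump a c e) s := by
  have heq : smoothBump a c e =ᶠ[nhds s] fun s => Real.smoothTransition ((s - a) / e) := by
    filter_upwards [Iio_mem_nhds h] with u hu
    rw [smoothBump, smoothTransition_div_eq_zero he (le_of_lt hu), sub_zero]
  rw [heq.deriv_eq]
  refine Monotone.deriv_nonneg (g := fun s => Real.smoothTransition ((s - a) / e)) ?_
  intro u v huv
  exact Real.smoothTransition.monotone (by gcongr)

lemma deriv_smoothBump_nonpos (he : 0 < e) (h : a + e < s) :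
    deriv (smoothBump a c e) s ≤ 0 := by
  have heq : smoothBump a c e =ᶠ[nhds s] fun s => 1 - Real.smoothTransition ((s - c) / e) := by
    filter_upwards [Ioi_mem_nhds h] with u hu
    rw [smoothBump, smoothTransition_div_eq_one he (le_of_lt hu)]
  rw [heq.deriv_eq]
  refine Antitone.deriv_nonpos (g := fun s => 1 - Real.smoothTransition ((s - c) / e)) ?_
  intro u v huv
  exact sub_le_sub_left (Real.smoothTransition.monotone (by gcongr)) _

lemma setIntegral_abs_deriv_smoothBump_le (he : 0 < e) (ha : 0 ≤ a) (hac : a + e < c)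
    (hc : c + e ≤ 1) : ∫ s in Set.Icc (0 : ℝ) 1, |deriv (smoothBump a c e) s| ≤ 2 := by
  have hcont : Continuous fun s => |deriv (smoothBump a c e) s| :=
    continuous_deriv_smoothBump.abs
  have hint : ∀ u v : ℝ, IntervalIntegrable (fun s => |deriv (smoothBump a c e) s|) volume u v :=
    fun u v => hcont.intervalIntegrable _ _
  -- the bump is monotone below any point of the plateau and antitone above it
  set b := (a + e + c) / 2 with hb
  have hb1 : a + e < b := by rw [hb]; linarith
  have hb2 : b < c := by rw [hb]; linarith
  rw [integral_Icc_eq_integral_Ioc, ← intervalIntegral.integral_of_le zero_le_one,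
    ← intervalIntegral.integral_add_adjacent_intervals (hint 0 b) (hint b 1)]
  have h1 : ∫ s in (0 : ℝ)..b, |deriv (smoothBump a c e) s| =
      ∫ s in (0 : ℝ)..b, deriv (smoothBump a c e) s := by
    refine intervalIntegral.integral_congr fun s hs => ?_
    rw [Set.uIcc_of_le (by linarith)] at hs
    exact abs_of_nonneg (deriv_smoothBump_nonneg he (hs.2.trans_lt hb2))
  have h2 : ∫ s in b..1, |deriv (smoothBump a c e) s| =
      ∫ s in b..1, -deriv (smoothBump a c e) s := by
    refine intervalIntegral.integral_congr fun s hs => ?_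
    rw [Set.uIcc_of_le (by linarith)] at hs
    exact abs_of_nonpos (deriv_smoothBump_nonpos he (hb1.trans_le hs.1))
  have hft : ∀ u v : ℝ, ∫ s in u..v, deriv (smoothBump a c e) s =
      smoothBump a c e v - smoothBump a c e u := fun u v =>
    intervalIntegral.integral_eq_sub_of_hasDerivAt (fun s _ => hasDerivAt_smoothBump)
      (continuous_deriv_smoothBump.intervalIntegrable _ _)
  rw [h1, h2, intervalIntegral.integral_neg, hft, hft, smoothBump_eq_one he hb1.le hb2.le,
    smoothBump_eq_zero_of_le he (by linarith) ha, smoothBump_eq_zero_of_ge he (by linarith) hc]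
  norm_num

end Bump

/-! ### Integral representation of the functions in the Sobolev space -/

section Representation

variable {d : ℕ}

/-- The open orthant `{x | x < t}` below `t`. -/
def boxBelow (t : EuclideanSpace ℝ (Fin d)) : Set (EuclideanSpace ℝ (Fin d)) :=
  {x | ∀ j, x j < t j}

/-- The product of smooth bumps that approximates, as `e → 0`, the indicator of the box between
`x` and the corner `(1, …, 1)`. -/
noncomputable def cornerBump (x : EuclideanSpace ℝ (Fin d)) (e : ℝ)
    (y : EuclideanSpace ℝ (Fin d)) : ℝ :=
  ∏ j, smoothBump (x j + e) (1 - 2 * e) e (y j)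

lemma eventually_lt_of_lt {u v : ℝ} (h : u < v) (k l : ℝ) :
    ∀ᶠ e in nhdsWithin (0 : ℝ) (Set.Ioi 0), u + k * e < v - l * e := by
  refine Filter.Eventually.filter_mono nhdsWithin_le_nhds ?_
  have h1 : Filter.Tendsto (fun e : ℝ => u + k * e) (nhds 0) (nhds (u + k * 0)) :=
    (continuous_const.add (continuous_const.mul continuous_id)).tendsto 0
  have h2 : Filter.Tendsto (fun e : ℝ => v - l * e) (nhds 0) (nhds (v - l * 0)) :=
    (continuous_const.sub (continuous_const.mul continuous_id)).tendsto 0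
  exact h1.eventually_lt h2 (by simpa using h)

lemma isTestFunction_cornerBump {x : EuclideanSpace ℝ (Fin d)} (hx0 : ∀ j, 0 ≤ x j) {e : ℝ}
    (he : 0 < e) (hxe : ∀ j, x j + 2 * e < 1 - 2 * e) : IsTestFunction (cornerBump x e) := by
  have hsub : tsupport (cornerBump x e) ⊆
      {y | ∀ j, x j + e ≤ y j ∧ y j ≤ 1 - 2 * e + e} := by
    refine closure_minimal (fun y hy j => ?_) (isClosed_box _ _)
    have hj : smoothBump (x j + e) (1 - 2 * e) e (y j) ≠ 0 :=
      Finset.prod_ne_zero_iff.1 hy j (Finset.mem_univ j)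
    exact tsupport_smoothBump_subset he (by linarith [hxe j]) (subset_tsupport _ hj)
  refine ⟨contDiff_prod_coord fun j => contDiff_smoothBump, ?_, fun y hy j => ?_⟩
  · refine isCompact_unitCube.of_isClosed_subset (isClosed_tsupport _) fun y hy j => ?_
    obtain ⟨h1, h2⟩ := hsub hy j
    exact ⟨by linarith [hx0 j], by linarith⟩
  · obtain ⟨h1, h2⟩ := hsub hy j
    exact ⟨by linarith [hx0 j], by linarith⟩

lemma integrable_of_continuousOn {f : EuclideanSpace ℝ (Fin d) → ℝ}
    (hf : ContinuousOn f (unitCube d)) : Integrable f (cubeMeasure d) :=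
  hf.integrableOn_compact isCompact_unitCube

/-- The mixed derivative of the corner bump concentrates near the vertices of the box between `x`
and `(1, …, 1)`; as `f` vanishes at all vertices but `x`, only `f x` survives in the limit. -/
lemma tendsto_integral_mul_deriv_cornerBump {f : EuclideanSpace ℝ (Fin d) → ℝ}
    (hf : ContinuousOn f (unitCube d)) (hf0 : ∀ x ∈ unitCube d, (∃ j, x j = 1) → f x = 0)
    {x : EuclideanSpace ℝ (Fin d)} (hx : x ∈ unitCube d) (hx1 : ∀ j, x j < 1) :
    Filter.Tendsto (fun e => ∫ y, f y * ∏ j, deriv (smoothBump (x j + e) (1 - 2 * e) e) (y j)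
      ∂(cubeMeasure d)) (nhdsWithin 0 (Set.Ioi 0)) (nhds (f x)) := by
  rw [Metric.tendsto_nhds]
  intro δ' hδ'
  -- the total variation of the mixed derivative of the bump is at most `2 ^ d`
  set δ : ℝ := δ' / 2 ^ (d + 1) with hδdef
  have hδ : 0 < δ := by positivity
  obtain ⟨η, hη, huc⟩ := Metric.uniformContinuousOn_iff.1
    (isCompact_unitCube.uniformContinuousOn_of_continuous hf) δ hδ
  have hsmall : ∀ᶠ e in nhdsWithin (0 : ℝ) (Set.Ioi 0), 0 + (√d * 2) * e < η - 0 * e :=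
    eventually_lt_of_lt hη _ _
  have hgap : ∀ᶠ e in nhdsWithin (0 : ℝ) (Set.Ioi 0), ∀ j, x j + 2 * e < 1 - 2 * e :=
    Filter.eventually_all.2 fun j => eventually_lt_of_lt (hx1 j) 2 2
  filter_upwards [hsmall, hgap, self_mem_nhdsWithin] with e hse hge he
  rw [Set.mem_Ioi] at he
  set D : Fin d → ℝ → ℝ := fun j => deriv (smoothBump (x j + e) (1 - 2 * e) e) with hD
  set L : Fin d → ℝ → ℝ := fun j => (Set.Icc (x j + e) (x j + e + e)).indicator (D j) with hL
  have hDc : ∀ j, Continuous (D j) := fun j => continuous_deriv_smoothBump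
  have hLint : ∫ y, ∏ j, L j (y j) ∂(cubeMeasure d) = 1 := by
    rw [integral_cubeMeasure_prod]
    refine Finset.prod_eq_one fun j _ => ?_
    rw [hL, setIntegral_indicator measurableSet_Icc, Set.inter_eq_right.2
      (Set.Icc_subset_Icc (by linarith [(hx j).1]) (by linarith [hge j])),
      setIntegral_deriv_smoothBump (by linarith),
      smoothBump_eq_one he le_rfl (by linarith [hge j]),
      smoothBump_eq_zero_of_le he (by linarith [hge j]) le_rfl, sub_zero]
  have hLi : Integrable (fun y : EuclideanSpace ℝ (Fin d) => ∏ j, L j (y j)) (cubeMeasure d) :=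
    integrable_cubeMeasure_prod fun j =>
      ((hDc j).continuousOn.integrableOn_compact isCompact_Icc).indicator measurableSet_Icc
  have hDi : Integrable (fun y : EuclideanSpace ℝ (Fin d) => f y * ∏ j, D j (y j))
      (cubeMeasure d) := by
    refine integrable_of_continuousOn (hf.mul (Continuous.continuousOn ?_))
    exact continuous_finsetProd _ fun j _ =>
      (hDc j).comp (EuclideanSpace.proj (𝕜 := ℝ) j).continuous
  have hAi : Integrable (fun y : EuclideanSpace ℝ (Fin d) => ∏ j, |D j (y j)|)
      (cubeMeasure d) :=
    integrable_cubeMeasure_prod (f := fun j s => |D j s|) fun j =>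
      (hDc j).abs.continuousOn.integrableOn_compact isCompact_Icc
  have hAint : ∫ y, ∏ j, |D j (y j)| ∂(cubeMeasure d) ≤ 2 ^ d := by
    rw [integral_cubeMeasure_prod fun j s => |D j s|]
    calc ∏ j, ∫ s in Set.Icc (0 : ℝ) 1, |D j s| ≤ ∏ _j : Fin d, (2 : ℝ) := by
          refine Finset.prod_le_prod (fun j _ => integral_nonneg fun s => abs_nonneg _)
            fun j _ => ?_
          exact setIntegral_abs_deriv_smoothBump_le he (by linarith [(hx j).1])
            (by linarith [hge j]) (by linarith)
      _ = 2 ^ d := by simp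
  have hpt : ∀ y ∈ unitCube d,
      |f y * ∏ j, D j (y j) - f x * ∏ j, L j (y j)| ≤ δ * ∏ j, |D j (y j)| := by
    intro y hy
    by_cases hne : ∀ j, D j (y j) ≠ 0
    · have hcase := fun j => deriv_smoothBump_ne_zero (a := x j + e) he
        (by linarith [hge j]) (hne j)
      by_cases hall : ∀ j, y j ∈ Set.Icc (x j + e) (x j + e + e)
      · have hLD : ∏ j, L j (y j) = ∏ j, D j (y j) :=
          Finset.prod_congr rfl fun j _ => Set.indicator_of_mem (hall j) _
        rw [hLD, ← sub_mul, abs_mul, Finset.abs_prod]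
        refine mul_le_mul_of_nonneg_right ?_ (Finset.prod_nonneg fun j _ => abs_nonneg _)
        refine (huc y hy x hx ?_).le
        refine (dist_le_sqrt_mul (r := 2 * e) (by linarith) fun j => ?_).trans_lt (by linarith)
        obtain ⟨h1, h2⟩ := hall j
        rw [abs_le]; constructor <;> linarith
      · push Not at hall
        obtain ⟨i, hi⟩ := hall
        have hL0 : ∏ j, L j (y j) = 0 :=
          Finset.prod_eq_zero (Finset.mem_univ i) (Set.indicator_of_notMem hi _)
        rw [hL0, mul_zero, sub_zero, abs_mul, Finset.abs_prod]
        refine mul_le_mul_of_nonneg_right ?_ (Finset.prod_nonneg fun j _ => abs_nonneg _)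
        -- compare with the projection of `y` to the face where the `i`-th coordinate is `1`
        set z : EuclideanSpace ℝ (Fin d) :=
          WithLp.toLp 2 (Function.update (WithLp.ofLp y) i 1) with hz
        have hzj : ∀ j, z j = if j = i then 1 else y j := fun j => by
          simp [hz, Function.update_apply]
        have hzc : z ∈ unitCube d := by
          intro j
          rw [hzj]; split_ifs
          · simp
          · exact hy j
        have hz0 : f z = 0 := hf0 z hzc ⟨i, by simp [hzj]⟩
        have hd := huc y hy z hzc (by
          refine (dist_le_sqrt_mul (r := 2 * e) (by linarith) fun j => ?_).trans_lt (by linarith)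
          rw [hzj]; split_ifs with hji
          · subst hji
            obtain ⟨h1, h2⟩ := (hcase j).resolve_left hi
            rw [abs_le]; constructor <;> linarith
          · simp; linarith)
        rw [Real.dist_eq, hz0, sub_zero] at hd
        exact hd.le
    · push Not at hne
      obtain ⟨i, hi⟩ := hne
      have h1 : ∏ j, D j (y j) = 0 := Finset.prod_eq_zero (Finset.mem_univ i) hi
      have h2 : ∏ j, L j (y j) = 0 := by
        refine Finset.prod_eq_zero (Finset.mem_univ i) ?_
        rw [hL]; dsimp only
        rw [Set.indicator_apply, hi, ite_self]
      rw [h1, h2, mul_zero, mul_zero, sub_zero, abs_zero]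
      exact mul_nonneg hδ.le (Finset.prod_nonneg fun j _ => abs_nonneg _)
  have hfx : f x = ∫ y, f x * ∏ j, L j (y j) ∂(cubeMeasure d) := by
    rw [integral_const_mul, hLint, mul_one]
  rw [Real.dist_eq]
  calc |∫ y, f y * ∏ j, D j (y j) ∂(cubeMeasure d) - f x|
      = |∫ y, (f y * ∏ j, D j (y j) - f x * ∏ j, L j (y j)) ∂(cubeMeasure d)| := by
        rw [integral_sub hDi (hLi.const_mul _), ← hfx]
    _ ≤ ∫ y, |f y * ∏ j, D j (y j) - f x * ∏ j, L j (y j)| ∂(cubeMeasure d) :=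
        abs_integral_le_integral_abs
    _ ≤ ∫ y, δ * ∏ j, |D j (y j)| ∂(cubeMeasure d) := by
        refine integral_mono_ae (hDi.sub (hLi.const_mul _)).abs (hAi.const_mul _) ?_
        filter_upwards [ae_mem_unitCube] with y hy using hpt y hy
    _ ≤ δ * 2 ^ d := by
        rw [integral_const_mul]
        exact mul_le_mul_of_nonneg_left hAint hδ.le
    _ < δ' := by
        rw [hδdef, pow_succ]
        field_simp
        norm_num

lemma tendsto_integral_mul_cornerBump {g : EuclideanSpace ℝ (Fin d) → ℝ}
    (hg : Integrable g (cubeMeasure d)) {x : EuclideanSpace ℝ (Fin d)} (hx1 : ∀ j, x j < 1) :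
    Filter.Tendsto (fun e => ∫ y, g y * cornerBump x e y ∂(cubeMeasure d))
      (nhdsWithin 0 (Set.Ioi 0))
      (nhds (∫ y, g y * (boxBelow y).indicator 1 x ∂(cubeMeasure d))) := by
  have hface : ∀ᵐ y ∂(cubeMeasure d), ∀ j, y j ≠ 1 := by
    rw [ae_all_iff]
    intro j
    exact ae_restrict_of_ae (measure_eq_zero_iff_ae_notMem.1 (volume_coord_eq j 1))
  refine tendsto_integral_filter_of_dominated_convergence (fun y => |g y|) ?_ ?_ hg.abs ?_
  · refine Filter.Eventually.of_forall fun e => hg.aestronglyMeasurable.mul ?_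
    exact (contDiff_prod_coord fun j => contDiff_smoothBump).continuous.aestronglyMeasurable
  · refine Filter.Eventually.of_forall fun e => Filter.Eventually.of_forall fun y => ?_
    rw [Real.norm_eq_abs, abs_mul, cornerBump, Finset.abs_prod]
    refine mul_le_of_le_one_right (abs_nonneg _) ?_
    exact Finset.prod_le_one (fun j _ => abs_nonneg _) fun j _ => abs_smoothBump_le
  · filter_upwards [hface, ae_mem_unitCube] with y hy1 hyc
    refine Filter.Tendsto.const_mul _ (tendsto_const_nhds.congr' ?_)
    have hgap : ∀ᶠ e in nhdsWithin (0 : ℝ) (Set.Ioi 0), ∀ j, x j + 2 * e < 1 - 2 * e :=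
      Filter.eventually_all.2 fun j => eventually_lt_of_lt (hx1 j) 2 2
    by_cases hxy : x ∈ boxBelow y
    · rw [Set.indicator_of_mem hxy, Pi.one_apply]
      have h1 : ∀ᶠ e in nhdsWithin (0 : ℝ) (Set.Ioi 0), ∀ j, x j + 2 * e < y j - 0 * e :=
        Filter.eventually_all.2 fun j => eventually_lt_of_lt (hxy j) 2 0
      have h2 : ∀ᶠ e in nhdsWithin (0 : ℝ) (Set.Ioi 0), ∀ j, y j + 0 * e < 1 - 2 * e :=
        Filter.eventually_all.2 fun j =>
          eventually_lt_of_lt (lt_of_le_of_ne (hyc j).2 (hy1 j)) 0 2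
      filter_upwards [h1, h2, self_mem_nhdsWithin] with e he1 he2 he
      exact (Finset.prod_eq_one fun j _ => smoothBump_eq_one he (by linarith [he1 j])
        (by linarith [he2 j])).symm
    · rw [Set.indicator_of_notMem hxy]
      have hex : ∃ j, y j ≤ x j := by simpa [boxBelow] using hxy
      obtain ⟨j, hj⟩ := hex
      filter_upwards [hgap, self_mem_nhdsWithin] with e hge he
      rw [Set.mem_Ioi] at he
      exact (Finset.prod_eq_zero (Finset.mem_univ j) (smoothBump_eq_zero_of_le he
        (by linarith [hge j]) (by linarith))).symm

lemma MemH1.memLp_weakMixedDeriv {f : EuclideanSpace ℝ (Fin d) → ℝ} (hf : MemH1 f) :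
    MemLp (weakMixedDeriv f) 2 (cubeMeasure d) := by
  rw [weakMixedDeriv, dif_pos hf.exists_deriv]
  exact hf.exists_deriv.choose_spec.1

lemma MemH1.isWeakMixedDeriv {f : EuclideanSpace ℝ (Fin d) → ℝ} (hf : MemH1 f) :
    IsWeakMixedDeriv f (weakMixedDeriv f) := by
  rw [weakMixedDeriv, dif_pos hf.exists_deriv]
  exact hf.exists_deriv.choose_spec.2

/-- A function of the Sobolev space is recovered from its weak mixed derivative by integration over
the box between `x` and the corner `(1, …, 1)`. -/
lemma MemH1.eq_integral {f : EuclideanSpace ℝ (Fin d) → ℝ} (hf : MemH1 f)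
    {x : EuclideanSpace ℝ (Fin d)} (hx : x ∈ unitCube d) :
    f x = (-1) ^ d * ∫ y, weakMixedDeriv f y * (boxBelow y).indicator 1 x ∂(cubeMeasure d) := by
  by_cases hx1 : ∀ j, x j < 1
  · have hg : Integrable (weakMixedDeriv f) (cubeMeasure d) :=
      hf.memLp_weakMixedDeriv.integrable one_le_two
    have h1 := tendsto_integral_mul_deriv_cornerBump hf.continuousOn hf.eq_zero hx hx1
    have h2 := (tendsto_integral_mul_cornerBump hg hx1).const_mul ((-1) ^ d)
    refine tendsto_nhds_unique h1 (h2.congr' ?_)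
    have hgap : ∀ᶠ e in nhdsWithin (0 : ℝ) (Set.Ioi 0), ∀ j, x j + 2 * e < 1 - 2 * e :=
      Filter.eventually_all.2 fun j => eventually_lt_of_lt (hx1 j) 2 2
    filter_upwards [hgap, self_mem_nhdsWithin] with e hge he
    rw [← hf.isWeakMixedDeriv _ (isTestFunction_cornerBump (fun j => (hx j).1) he hge)]
    refine integral_congr_ae (Filter.Eventually.of_forall fun y => ?_)
    exact congrArg (f y * ·) (mixedPartial_prod_coord (fun j => contDiff_smoothBump) y)
  · push Not at hx1
    obtain ⟨j, hj⟩ := hx1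
    rw [hf.eq_zero x hx ⟨j, le_antisymm (hx j).2 hj⟩, integral_eq_zero_of_ae, mul_zero]
    filter_upwards [ae_mem_unitCube] with y hy
    have hxy : x ∉ boxBelow y := fun h => absurd (h j) (not_lt.2 ((hy j).2.trans hj))
    simp [hxy]

end Representation

/-! ### The worst-case error and the discrepancy function -/

section WorstCase

variable {d N : ℕ}

lemma measurableSet_boxBelow_prod :
    MeasurableSet {p : EuclideanSpace ℝ (Fin d) × EuclideanSpace ℝ (Fin d) |
      p.1 ∈ boxBelow p.2} := by
  have h : {p : EuclideanSpace ℝ (Fin d) × EuclideanSpace ℝ (Fin d) | p.1 ∈ boxBelow p.2} =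
      ⋂ j, {p | p.1 j < p.2 j} := by ext p; simp [boxBelow]
  rw [h]
  exact MeasurableSet.iInter fun j => measurableSet_lt (by fun_prop) (by fun_prop)

lemma measurableSet_boxBelow (t : EuclideanSpace ℝ (Fin d)) : MeasurableSet (boxBelow t) :=
  measurableSet_boxBelow_prod.preimage (measurable_id.prodMk measurable_const)

lemma measurable_indicator_boxBelow {α : Type*} [MeasurableSpace α]
    {x t : α → EuclideanSpace ℝ (Fin d)} (hx : Measurable x) (ht : Measurable t) :
    Measurable fun a => (boxBelow (t a)).indicator (1 : EuclideanSpace ℝ (Fin d) → ℝ) (x a) := by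
  have h : Measurable (Set.indicator {p : EuclideanSpace ℝ (Fin d) × EuclideanSpace ℝ (Fin d) |
      p.1 ∈ boxBelow p.2} (fun _ => (1 : ℝ))) := measurable_const.indicator measurableSet_boxBelow_prod
  exact h.comp (hx.prodMk ht)

lemma indicator_boxBelow_nonneg (x t : EuclideanSpace ℝ (Fin d)) :
    (0 : ℝ) ≤ (boxBelow t).indicator 1 x :=
  Set.indicator_nonneg (fun _ _ => zero_le_one) x

lemma indicator_boxBelow_le_one (x t : EuclideanSpace ℝ (Fin d)) :
    (boxBelow t).indicator (1 : EuclideanSpace ℝ (Fin d) → ℝ) x ≤ 1 :=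
  Set.indicator_le_self' (fun _ _ => zero_le_one) x

lemma integral_indicator_boxBelow {t : EuclideanSpace ℝ (Fin d)} (ht : t ∈ unitCube d) :
    ∫ x, (boxBelow t).indicator 1 x ∂(cubeMeasure d) = ∏ j, t j := by
  have h : ∀ x : EuclideanSpace ℝ (Fin d), (boxBelow t).indicator (1 : EuclideanSpace ℝ (Fin d) → ℝ) x =
      ∏ j, (Set.Iio (t j)).indicator (1 : ℝ → ℝ) (x j) := by
    intro x
    by_cases hx : x ∈ boxBelow t
    · rw [Set.indicator_of_mem hx]
      exact (Finset.prod_eq_one fun j _ =>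
        Set.indicator_of_mem (s := Set.Iio (t j)) (hx j) _).symm
    · rw [Set.indicator_of_notMem hx]
      have hex : ∃ j, t j ≤ x j := by simpa [boxBelow] using hx
      obtain ⟨j, hj⟩ := hex
      exact (Finset.prod_eq_zero (Finset.mem_univ j)
        (Set.indicator_of_notMem (s := Set.Iio (t j)) (not_lt.2 hj) _)).symm
  simp only [h]
  rw [integral_cubeMeasure_prod fun j => (Set.Iio (t j)).indicator 1]
  refine Finset.prod_congr rfl fun j _ => ?_
  rw [setIntegral_indicator measurableSet_Iio]
  have hset : Set.Icc (0 : ℝ) 1 ∩ Set.Iio (t j) = Set.Ico 0 (t j) := by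
    ext s
    simp only [Set.mem_inter_iff, Set.mem_Icc, Set.mem_Iio, Set.mem_Ico]
    exact ⟨fun h => ⟨h.1.1, h.2⟩, fun h => ⟨⟨h.1, h.2.le.trans (ht j).2⟩, h.2⟩⟩
  rw [hset]
  simp [(ht j).1]

/-- The difference, at the corner `t`, between the fraction of the points `x n` in the box `[0, t)`
and the volume of that box. -/
noncomputable def discrepancy (x : Fin N → EuclideanSpace ℝ (Fin d))
    (t : EuclideanSpace ℝ (Fin d)) : ℝ :=
  1 / (N : ℝ) * ∑ n, (boxBelow t).indicator 1 (x n) - ∏ j, t j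

lemma measurable_discrepancy {α : Type*} [MeasurableSpace α]
    {x : Fin N → α → EuclideanSpace ℝ (Fin d)} {t : α → EuclideanSpace ℝ (Fin d)}
    (hx : ∀ n, Measurable (x n)) (ht : Measurable t) :
    Measurable fun a => discrepancy (fun n => x n a) (t a) := by
  unfold discrepancy
  refine Measurable.sub (Measurable.const_mul (Finset.measurable_sum _ fun n _ =>
    measurable_indicator_boxBelow (hx n) ht) _) (Finset.measurable_prod _ fun j _ => ?_)
  exact (EuclideanSpace.proj (𝕜 := ℝ) j).continuous.measurable.comp ht

lemma abs_discrepancy_le (x : Fin N → EuclideanSpace ℝ (Fin d)) {t : EuclideanSpace ℝ (Fin d)}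
    (ht : t ∈ unitCube d) : |discrepancy x t| ≤ 1 := by
  have h1 : 0 ≤ ∏ j, t j := Finset.prod_nonneg fun j _ => (ht j).1
  have h2 : ∏ j, t j ≤ 1 := Finset.prod_le_one (fun j _ => (ht j).1) fun j _ => (ht j).2
  have h3 : (0 : ℝ) ≤ 1 / (N : ℝ) * ∑ n, (boxBelow t).indicator 1 (x n) :=
    mul_nonneg (by positivity) (Finset.sum_nonneg fun n _ => indicator_boxBelow_nonneg _ _)
  have h4 : 1 / (N : ℝ) * ∑ n, (boxBelow t).indicator 1 (x n) ≤ (1 : ℝ) := by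
    have h5 : ∑ n, (boxBelow t).indicator 1 (x n) ≤ (N : ℝ) := by
      calc ∑ n, (boxBelow t).indicator 1 (x n) ≤ ∑ _n : Fin N, (1 : ℝ) :=
            Finset.sum_le_sum fun n _ => indicator_boxBelow_le_one _ _
        _ = N := by simp
    calc 1 / (N : ℝ) * ∑ n, (boxBelow t).indicator 1 (x n) ≤ 1 / (N : ℝ) * N := by gcongr
      _ ≤ 1 := by rw [one_div]; exact inv_mul_le_one
  rw [discrepancy, abs_le]
  constructor <;> linarith

lemma MemH1.integral_eq {f : EuclideanSpace ℝ (Fin d) → ℝ} (hf : MemH1 f) :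
    ∫ x, f x ∂(cubeMeasure d) =
      (-1) ^ d * ∫ y, weakMixedDeriv f y * ∏ j, y j ∂(cubeMeasure d) := by
  have hg : Integrable (weakMixedDeriv f) (cubeMeasure d) :=
    hf.memLp_weakMixedDeriv.integrable one_le_two
  have h1 : ∫ x, f x ∂(cubeMeasure d) = ∫ x, (-1) ^ d *
      ∫ y, weakMixedDeriv f y * (boxBelow y).indicator 1 x ∂(cubeMeasure d) ∂(cubeMeasure d) := by
    refine integral_congr_ae ?_
    filter_upwards [ae_mem_unitCube] with x hx using hf.eq_integral hx
  have hint : Integrable (Function.uncurry fun x y : EuclideanSpace ℝ (Fin d) =>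
      weakMixedDeriv f y * (boxBelow y).indicator 1 x) ((cubeMeasure d).prod (cubeMeasure d)) := by
    refine (hg.comp_snd (cubeMeasure d)).mul_bdd (c := 1) ?_ ?_
    · exact (measurable_indicator_boxBelow measurable_fst measurable_snd).aestronglyMeasurable
    · refine Filter.Eventually.of_forall fun p => ?_
      rw [Real.norm_eq_abs, abs_of_nonneg (indicator_boxBelow_nonneg _ _)]
      exact indicator_boxBelow_le_one _ _
  rw [h1, integral_const_mul, integral_integral_swap hint]
  congr 1
  refine integral_congr_ae ?_
  filter_upwards [ae_mem_unitCube] with y hy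
  rw [integral_const_mul, integral_indicator_boxBelow hy]

lemma MemH1.error_eq {f : EuclideanSpace ℝ (Fin d) → ℝ} (hf : MemH1 f)
    {x : Fin N → EuclideanSpace ℝ (Fin d)} (hx : ∀ n, x n ∈ unitCube d) :
    1 / (N : ℝ) * ∑ n, f (x n) - ∫ t, f t ∂(cubeMeasure d) =
      (-1) ^ d * ∫ y, weakMixedDeriv f y * discrepancy x y ∂(cubeMeasure d) := by
  have hg : Integrable (weakMixedDeriv f) (cubeMeasure d) :=
    hf.memLp_weakMixedDeriv.integrable one_le_two
  have hi : ∀ n, Integrable (fun y => weakMixedDeriv f y * (boxBelow y).indicator 1 (x n))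
      (cubeMeasure d) := by
    intro n
    refine hg.mul_bdd (c := 1) ?_ ?_
    · exact (measurable_indicator_boxBelow measurable_const measurable_id).aestronglyMeasurable
    · refine Filter.Eventually.of_forall fun p => ?_
      rw [Real.norm_eq_abs, abs_of_nonneg (indicator_boxBelow_nonneg _ _)]
      exact indicator_boxBelow_le_one _ _
  have hp : Integrable (fun y : EuclideanSpace ℝ (Fin d) => weakMixedDeriv f y * ∏ j, y j)
      (cubeMeasure d) := by
    refine hg.mul_bdd (c := 1) ?_ ?_
    · exact (continuous_finsetProd _ fun j _ =>
        (EuclideanSpace.proj (𝕜 := ℝ) j).continuous).aestronglyMeasurable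
    · filter_upwards [ae_mem_unitCube] with y hy
      rw [Real.norm_eq_abs, abs_of_nonneg (Finset.prod_nonneg fun j _ => (hy j).1)]
      exact Finset.prod_le_one (fun j _ => (hy j).1) fun j _ => (hy j).2
  rw [hf.integral_eq, Finset.sum_congr rfl fun n _ => hf.eq_integral (hx n), ← Finset.mul_sum,
    ← integral_finsetSum _ fun n _ => hi n, mul_left_comm, ← mul_sub, ← integral_const_mul,
    ← integral_sub ((integrable_finsetSum _ fun n _ => hi n).const_mul _) hp]
  congr 2
  funext y
  rw [discrepancy, mul_sub, ← Finset.mul_sum]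
  ring

/-- The squared worst-case error is at most the squared `L²`-norm of the discrepancy function, by
the Cauchy–Schwarz inequality. -/
lemma sqWorstCaseError_le {x : Fin N → EuclideanSpace ℝ (Fin d)} (hx : ∀ n, x n ∈ unitCube d) :
    sqWorstCaseError x ≤ ∫⁻ t, ENNReal.ofReal (discrepancy x t ^ 2) ∂(cubeMeasure d) := by
  have hDm : Measurable (discrepancy x) :=
    measurable_discrepancy (fun n => measurable_const) measurable_id
  have hDb : ∀ᵐ t ∂(cubeMeasure d), ‖discrepancy x t‖ ≤ 1 := by
    filter_upwards [ae_mem_unitCube] with t ht using abs_discrepancy_le x ht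
  have hD : MemLp (discrepancy x) 2 (cubeMeasure d) :=
    MemLp.of_bound hDm.aestronglyMeasurable 1 hDb
  rw [← ofReal_integral_eq_lintegral_ofReal hD.integrable_sq
    (Filter.Eventually.of_forall fun t => sq_nonneg _)]
  refine iSup₂_le fun f hf => ENNReal.ofReal_le_ofReal ?_
  obtain ⟨hf, hnorm⟩ := hf
  set g := weakMixedDeriv f with hgdef
  have hg : MemLp g 2 (cubeMeasure d) := hf.memLp_weakMixedDeriv
  have hg1 : ∫ t, g t ^ 2 ∂(cubeMeasure d) ≤ 1 := by
    rw [h1Norm, Real.sqrt_le_one, h1Inner] at hnorm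
    simpa only [sq] using hnorm
  have hgD : Integrable (fun t => g t * discrepancy x t) (cubeMeasure d) :=
    hg.integrable_mul hD
  rw [hf.error_eq hx, abs_mul, abs_pow, abs_neg, abs_one, one_pow, one_mul, sq_abs]
  set I := ∫ t, g t * discrepancy x t ∂(cubeMeasure d) with hI
  have hnonneg : 0 ≤ ∫ t, (discrepancy x t - I * g t) ^ 2 ∂(cubeMeasure d) :=
    integral_nonneg fun t => sq_nonneg _
  have hexp : ∫ t, (discrepancy x t - I * g t) ^ 2 ∂(cubeMeasure d) =
      ∫ t, discrepancy x t ^ 2 ∂(cubeMeasure d) - 2 * I * I +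
        I ^ 2 * ∫ t, g t ^ 2 ∂(cubeMeasure d) := by
    have h1 : ∀ t, (discrepancy x t - I * g t) ^ 2 =
        discrepancy x t ^ 2 - 2 * I * (g t * discrepancy x t) + I ^ 2 * g t ^ 2 :=
      fun t => by ring
    simp only [h1]
    have hi : Integrable (fun t => discrepancy x t ^ 2 - 2 * I * (g t * discrepancy x t))
        (cubeMeasure d) := hD.integrable_sq.sub (hgD.const_mul _)
    rw [integral_add hi (hg.integrable_sq.const_mul _),
      integral_sub hD.integrable_sq (hgD.const_mul _), integral_const_mul, integral_const_mul, ← hI]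
  nlinarith [mul_le_mul_of_nonneg_left hg1 (sq_nonneg I)]

/-- The coordinatewise retraction of the space onto the unit cube. -/
noncomputable def clampCube (x : EuclideanSpace ℝ (Fin d)) : EuclideanSpace ℝ (Fin d) :=
  WithLp.toLp 2 fun j => max 0 (min (x j) 1)

lemma continuous_clampCube : Continuous (clampCube (d := d)) := by
  refine (PiLp.continuous_toLp 2 (fun _ : Fin d => ℝ)).comp (continuous_pi fun j => ?_)
  exact continuous_const.max ((EuclideanSpace.proj (𝕜 := ℝ) j).continuous.min continuous_const)

lemma clampCube_mem (x : EuclideanSpace ℝ (Fin d)) : clampCube x ∈ unitCube d :=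
  fun _ => ⟨le_max_left _ _, max_le zero_le_one (min_le_right _ _)⟩

lemma clampCube_of_mem {x : EuclideanSpace ℝ (Fin d)} (hx : x ∈ unitCube d) :
    clampCube x = x := by
  ext j
  change max 0 (min (x j) 1) = x j
  rw [min_eq_left (hx j).2, max_eq_right (hx j).1]

/-- As a supremum of continuous functions of the points, the worst-case error is lower
semicontinuous. -/
lemma lowerSemicontinuous_sqWorstCaseError_clampCube :
    LowerSemicontinuous fun x : Fin N → EuclideanSpace ℝ (Fin d) =>
      sqWorstCaseError fun n => clampCube (x n) := by
  refine lowerSemicontinuous_iSup fun f => lowerSemicontinuous_iSup fun hf =>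
    Continuous.lowerSemicontinuous ?_
  have hc : ∀ n : Fin N, Continuous fun x : Fin N → EuclideanSpace ℝ (Fin d) =>
      f (clampCube (x n)) := fun n =>
    hf.1.continuousOn.comp_continuous (continuous_clampCube.comp (continuous_apply n))
      fun x => clampCube_mem _
  exact ENNReal.continuous_ofReal.comp (((continuous_const.mul
    (continuous_finsetSum _ fun n _ => hc n)).sub continuous_const).abs.pow 2)

lemma aemeasurable_sqWorstCaseError {Ω : Type*} [MeasurableSpace Ω] {P : Measure Ω}
    {X : Fin N → Ω → EuclideanSpace ℝ (Fin d)} (hX : ∀ n, AEMeasurable (X n) P)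
    (hc : ∀ n, ∀ᵐ ω ∂P, X n ω ∈ unitCube d) :
    AEMeasurable (fun ω => sqWorstCaseError fun n => X n ω) P := by
  refine ((lowerSemicontinuous_sqWorstCaseError_clampCube.measurable).comp_aemeasurable
    (aemeasurable_pi_lambda _ hX)).congr ?_
  filter_upwards [ae_all_iff.2 hc] with ω hω
  exact congrArg sqWorstCaseError (funext fun n => clampCube_of_mem (hω n))

end WorstCase

/-! ### Strata that cross the boundary of a box -/

section Strata

variable {d N : ℕ} {H : ℝ → EuclideanSpace ℝ (Fin d)}

lemma IsHilbertCurve.isProbabilityMeasure_cond (hd : d ≠ 0) (hH : IsHilbertCurve H) (s : Fin N) :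
    IsProbabilityMeasure (volume[|stratum H N s]) := by
  refine cond_isProbabilityMeasure_of_finite ?_ ?_
  · rw [hH.volume_stratum hd]; simp
  · rw [hH.volume_stratum hd]
    have : (N : ℝ≥0∞) ≠ 0 := by exact_mod_cast s.pos.ne'
    simp [this]

lemma IsHilbertCurve.cond_stratum_apply (hd : d ≠ 0) (hH : IsHilbertCurve H) (s : Fin N)
    (A : Set (EuclideanSpace ℝ (Fin d))) :
    volume[|stratum H N s] A = N * volume (stratum H N s ∩ A) := by
  rw [cond_apply (hH.isCompact_stratum s).measurableSet, hH.volume_stratum hd, inv_inv]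

/-- The strata have equal measure, so the conditional probabilities of a set average to its
measure. -/
lemma IsHilbertCurve.sum_cond_stratum (hd : d ≠ 0) (hH : IsHilbertCurve H) (hN : 0 < N)
    {A : Set (EuclideanSpace ℝ (Fin d))} (hA : MeasurableSet A) :
    ∑ s : Fin N, (volume[|stratum H N s]).real A = N * (cubeMeasure d).real A := by
  have hsum : ∑ s : Fin N, volume (stratum H N s ∩ A) = cubeMeasure d A := by
    rw [cubeMeasure, Measure.restrict_apply hA, ← hH.iUnion_stratum hN, Set.inter_iUnion,
      measure_iUnion₀ (fun i j hij => ((hH.aedisjoint_stratum hd) hij).mono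
        Set.inter_subset_right Set.inter_subset_right)
        (fun i => (hA.inter (hH.isCompact_stratum i).measurableSet).nullMeasurableSet),
      tsum_fintype]
    exact Finset.sum_congr rfl fun s _ => by rw [Set.inter_comm]
  simp only [Measure.real, hH.cond_stratum_apply hd, ENNReal.toReal_mul, ENNReal.toReal_natCast]
  rw [← Finset.mul_sum, ← hsum, ENNReal.toReal_sum]
  intro s _
  exact ne_top_of_le_ne_top (by rw [hH.volume_stratum hd]; simpa using s.pos.ne')
    (measure_mono (Set.inter_subset_left (s := stratum H N s)))

open Classical in
/-- The strata that meet the box below `t` without being contained in it. -/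
noncomputable def crossingStrata (H : ℝ → EuclideanSpace ℝ (Fin d)) (N : ℕ)
    (t : EuclideanSpace ℝ (Fin d)) : Finset (Fin N) :=
  Finset.univ.filter fun s => (stratum H N s ∩ boxBelow t).Nonempty ∧ ¬ stratum H N s ⊆ boxBelow t

lemma mem_crossingStrata {t : EuclideanSpace ℝ (Fin d)} {s : Fin N} :
    s ∈ crossingStrata H N t ↔
      (stratum H N s ∩ boxBelow t).Nonempty ∧ ¬ stratum H N s ⊆ boxBelow t := by
  simp [crossingStrata]

/-- The crossing strata lie in the `d` slabs around the facets of the box whose half-width is the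
coordinatewise extent of a stratum; comparing volumes bounds their number. -/
lemma IsHilbertCurve.card_crossingStrata_le (hd : d ≠ 0) (hH : IsHilbertCurve H)
    (t : EuclideanSpace ℝ (Fin d)) :
    ((crossingStrata H N t).card : ℝ) ≤ 8 * d * N * (1 / (N : ℝ)) ^ (1 / (d : ℝ)) := by
  rcases Nat.eq_zero_or_pos N with rfl | hN
  · have h0 : (crossingStrata H 0 t).card = 0 := by
      rw [Finset.card_eq_zero]; exact Finset.eq_empty_of_isEmpty _
    rw [h0]; simp
  set r : ℝ := 4 * (1 / (N : ℝ)) ^ (1 / (d : ℝ)) with hr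
  have hr0 : 0 ≤ r := by positivity
  have hsub : ∀ s ∈ crossingStrata H N t, stratum H N s ⊆
      ⋃ j : Fin d, {x ∈ unitCube d | t j - r ≤ x j ∧ x j ≤ t j + r} := by
    intro s hs z hz
    obtain ⟨⟨x, hxs, hxt⟩, hns⟩ := mem_crossingStrata.1 hs
    obtain ⟨y, hys, hyt⟩ := Set.not_subset.1 hns
    have hex : ∃ j, t j ≤ y j := by simpa [boxBelow] using hyt
    obtain ⟨j, hj⟩ := hex
    refine Set.mem_iUnion.2 ⟨j, hH.stratum_subset s hz, ?_, ?_⟩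
    · have := (abs_le.1 (hH.abs_sub_le_of_mem_stratum hys hz j)).2
      linarith
    · have := (abs_le.1 (hH.abs_sub_le_of_mem_stratum hz hxs j)).2
      linarith [hxt j]
  have hvol : ((crossingStrata H N t).card : ℝ≥0∞) * (N : ℝ≥0∞)⁻¹ ≤
      d * ENNReal.ofReal (2 * r) := by
    calc ((crossingStrata H N t).card : ℝ≥0∞) * (N : ℝ≥0∞)⁻¹
        = ∑ s ∈ crossingStrata H N t, volume (stratum H N s) := by
          rw [Finset.sum_congr rfl fun s _ => hH.volume_stratum hd s, Finset.sum_const,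
            nsmul_eq_mul]
      _ = volume (⋃ s ∈ crossingStrata H N t, stratum H N s) :=
          (measure_biUnion_finset₀ (fun i _ j _ hij => (hH.aedisjoint_stratum hd) hij)
            fun i _ => (hH.isCompact_stratum i).measurableSet.nullMeasurableSet).symm
      _ ≤ volume (⋃ j : Fin d, {x ∈ unitCube d | t j - r ≤ x j ∧ x j ≤ t j + r}) :=
          measure_mono (Set.iUnion₂_subset hsub)
      _ ≤ ∑ j : Fin d, volume {x ∈ unitCube d | t j - r ≤ x j ∧ x j ≤ t j + r} :=
          measure_iUnion_fintype_le _ _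
      _ ≤ ∑ _j : Fin d, ENNReal.ofReal (2 * r) := by
          refine Finset.sum_le_sum fun j _ => (volume_slab_le j _ _).trans_eq ?_
          congr 1; ring
      _ = d * ENNReal.ofReal (2 * r) := by simp
  have hN' : (0 : ℝ) < N := by exact_mod_cast hN
  have hreal := ENNReal.toReal_mono (by finiteness) hvol
  rw [ENNReal.toReal_mul, ENNReal.toReal_mul, ENNReal.toReal_inv, ENNReal.toReal_natCast,
    ENNReal.toReal_natCast, ENNReal.toReal_natCast, ENNReal.toReal_ofReal (by positivity),
    ← div_eq_mul_inv, div_le_iff₀ hN'] at hreal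
  refine hreal.trans_eq ?_
  rw [hr]; ring

/-- The indicator of the box has variance at most `1/4` on a crossing stratum and is constant on all
other strata. -/
lemma IsHilbertCurve.sum_variance_le (hd : d ≠ 0) (hH : IsHilbertCurve H)
    (t : EuclideanSpace ℝ (Fin d)) :
    ∑ s : Fin N, ((volume[|stratum H N s]).real (boxBelow t) -
      (volume[|stratum H N s]).real (boxBelow t) ^ 2) ≤
        2 * d * N * (1 / (N : ℝ)) ^ (1 / (d : ℝ)) := by
  classical
  have hle : ∀ s : Fin N, (volume[|stratum H N s]).real (boxBelow t) -
      (volume[|stratum H N s]).real (boxBelow t) ^ 2 ≤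
        if s ∈ crossingStrata H N t then 1 / 4 else 0 := by
    intro s
    have := hH.isProbabilityMeasure_cond hd s
    split_ifs with hs
    · nlinarith [sq_nonneg ((volume[|stratum H N s]).real (boxBelow t) - 1 / 2)]
    · rw [mem_crossingStrata, not_and_or, not_not, Set.not_nonempty_iff_eq_empty] at hs
      rcases hs with hs | hs
      · rw [Measure.real, hH.cond_stratum_apply hd, hs]; simp
      · have h1 : (volume[|stratum H N s]) (boxBelow t) = 1 := by
          have h0 : (N : ℝ≥0∞) ≠ 0 := by exact_mod_cast s.pos.ne'
          rw [hH.cond_stratum_apply hd, Set.inter_eq_left.2 hs, hH.volume_stratum hd,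
            ENNReal.mul_inv_cancel h0 (ENNReal.natCast_ne_top N)]
        rw [Measure.real, h1]; simp
  refine (Finset.sum_le_sum fun s _ => hle s).trans ?_
  rw [Finset.sum_ite_mem, Finset.univ_inter, Finset.sum_const, nsmul_eq_mul]
  linarith [hH.card_crossingStrata_le (N := N) hd t]

end Strata

/-! ### Stratified samples -/

/-- The points `X i` form a stratified sample: `X i` lies in the random stratum with index `σ i`,
every stratum is used exactly once and, independently of the information `G i` (which comprises all
indices `σ k` and all other points), `X i` is uniformly distributed in its stratum.  The last
requirement is expressed by auxiliary points `Y`, one for each possible value of `σ i`. -/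
structure IsStratifiedSample {d N : ℕ} (H : ℝ → EuclideanSpace ℝ (Fin d)) {Ω : Type*}
    [mΩ : MeasurableSpace Ω] (P : Measure Ω) (X : Fin N → Ω → EuclideanSpace ℝ (Fin d))
    (σ : Fin N → Ω → Fin N) (G : Fin N → MeasurableSpace Ω) : Prop where
  le : ∀ i, G i ≤ mΩ
  measurable_index : ∀ i k, Measurable[G i] (σ k)
  measurable_point : ∀ i k, k ≠ i → Measurable[G i] (X k)
  measurable : ∀ i, Measurable (X i)
  bijective : ∀ ω, Function.Bijective fun i => σ i ω
  exists_uniform : ∀ i s, (∃ ω, σ i ω = s) → ∃ Y : Ω → EuclideanSpace ℝ (Fin d),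
    Measurable Y ∧ pdf.IsUniform Y (stratum H N s) P volume ∧
      Indep (MeasurableSpace.comap Y inferInstance) (G i) P ∧ ∀ ω, σ i ω = s → X i ω = Y ω

section Sample

variable {d N : ℕ} {H : ℝ → EuclideanSpace ℝ (Fin d)} {Ω : Type*} [mΩ : MeasurableSpace Ω]
  {P : Measure Ω} {X : Fin N → Ω → EuclideanSpace ℝ (Fin d)}
  {σ : Fin N → Ω → Fin N} {G : Fin N → MeasurableSpace Ω}

/-- The point `X i` may be integrated out over its stratum, all other randomness being fixed. -/
lemma IsStratifiedSample.integral_mul [IsProbabilityMeasure P]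
    (hS : IsStratifiedSample H P X σ G) (i : Fin N)
    {φ : Fin N → EuclideanSpace ℝ (Fin d) → ℝ} (hφ : ∀ s, Measurable (φ s)) {C : ℝ}
    (hφC : ∀ s x, |φ s x| ≤ C) {W : Ω → ℝ} (hW : Measurable[G i] W) {C' : ℝ}
    (hWC : ∀ ω, |W ω| ≤ C') :
    ∫ ω, φ (σ i ω) (X i ω) * W ω ∂P =
      ∫ ω, (∫ x, φ (σ i ω) x ∂(volume[|stratum H N (σ i ω)])) * W ω ∂P := by
  classical
  have hσ : ∀ s, MeasurableSet[G i] {ω | σ i ω = s} := fun s =>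
    hS.measurable_index i i (measurableSet_singleton s)
  have hWs : ∀ s, Measurable[G i] ({ω | σ i ω = s}.indicator W) := fun s => hW.indicator (hσ s)
  have hWsC : ∀ s ω, |{ω | σ i ω = s}.indicator W ω| ≤ C' := by
    intro s ω
    rw [Set.indicator_apply]
    split_ifs
    · exact hWC ω
    · rw [abs_zero]; exact (abs_nonneg _).trans (hWC ω)
  have hC0 : ∀ s : Fin N, 0 ≤ C := fun s => (abs_nonneg _).trans (hφC s 0)
  have hleft : ∀ ω, φ (σ i ω) (X i ω) * W ω =
      ∑ s : Fin N, φ s (X i ω) * {ω | σ i ω = s}.indicator W ω := by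
    intro ω
    simp [Set.indicator_apply]
  have hright : ∀ ω, (∫ x, φ (σ i ω) x ∂(volume[|stratum H N (σ i ω)])) * W ω =
      ∑ s : Fin N, (∫ x, φ s x ∂(volume[|stratum H N s])) * {ω | σ i ω = s}.indicator W ω := by
    intro ω
    simp [Set.indicator_apply]
  simp only [hleft, hright]
  have hWi : ∀ s, Integrable ({ω | σ i ω = s}.indicator W) P := fun s =>
    Integrable.of_bound ((hWs s).mono (hS.le i) le_rfl).aestronglyMeasurable C'
      (Filter.Eventually.of_forall (hWsC s))
  rw [integral_finsetSum, integral_finsetSum]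
  · refine Finset.sum_congr rfl fun s _ => ?_
    rw [integral_const_mul]
    by_cases hs : ∃ ω, σ i ω = s
    · obtain ⟨Y, hY, hYu, hYi, hYX⟩ := hS.exists_uniform i s hs
      have h1 : ∀ ω, φ s (X i ω) * {ω | σ i ω = s}.indicator W ω =
          φ s (Y ω) * {ω | σ i ω = s}.indicator W ω := by
        intro ω
        by_cases hω : σ i ω = s
        · rw [hYX ω hω]
        · rw [Set.indicator_of_notMem (by exact hω), mul_zero, mul_zero]
      simp only [h1]
      have hind : IndepFun (fun ω => φ s (Y ω)) ({ω | σ i ω = s}.indicator W) P := by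
        rw [IndepFun_iff_Indep]
        refine indep_of_indep_of_le_left (indep_of_indep_of_le_right hYi (hWs s).comap_le) ?_
        exact ((hφ s).comp (comap_measurable Y)).comap_le
      have h2 := hind.integral_fun_mul_eq_mul_integral
        ((hφ s).comp hY).aestronglyMeasurable (hWi s).aestronglyMeasurable
      refine h2.trans ?_
      congr 1
      rw [← hYu, integral_map hY.aemeasurable (hφ s).aestronglyMeasurable]
    · have h0 : {ω | σ i ω = s}.indicator W = 0 := by
        funext ω
        exact Set.indicator_of_notMem (s := {ω | σ i ω = s}) (fun h => hs ⟨ω, h⟩) W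
      simp [h0]
  · exact fun s _ => (hWi s).const_mul _
  · intro s _
    refine Integrable.of_bound (C := C * C') (((hφ s).comp (hS.measurable i)).mul
      ((hWs s).mono (hS.le i) le_rfl)).aestronglyMeasurable
      (Filter.Eventually.of_forall fun ω => ?_)
    rw [Real.norm_eq_abs, abs_mul]
    exact mul_le_mul (hφC s _) (hWsC s ω) (abs_nonneg _) (hC0 s)

lemma IsStratifiedSample.ae_mem_unitCube (hH : IsHilbertCurve H)
    (hS : IsStratifiedSample H P X σ G) (i : Fin N) : ∀ᵐ ω ∂P, X i ω ∈ unitCube d := by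
  have h : ∀ s, ∀ᵐ ω ∂P, σ i ω = s → X i ω ∈ unitCube d := by
    intro s
    by_cases hs : ∃ ω, σ i ω = s
    · obtain ⟨Y, hY, hYu, -, hYX⟩ := hS.exists_uniform i s hs
      have hmem : ∀ᵐ x ∂(P.map Y), x ∈ unitCube d := by
        rw [hYu]
        filter_upwards [ae_cond_mem (hH.isCompact_stratum s).measurableSet] with x hx
          using hH.stratum_subset s hx
      filter_upwards [ae_of_ae_map hY.aemeasurable hmem] with ω hω hσ
      rwa [hYX ω hσ]
    · exact Filter.Eventually.of_forall fun ω h => absurd ⟨ω, h⟩ hs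
  filter_upwards [ae_all_iff.2 h] with ω hω using hω _ rfl

/-- The pointwise mean square of the discrepancy function of a stratified sample: centred within
their strata, the indicators of the box are uncorrelated, and only crossing strata contribute. -/
lemma IsStratifiedSample.integral_discrepancy_sq_le [IsProbabilityMeasure P] (hd : d ≠ 0)
    (hH : IsHilbertCurve H) (hN : 0 < N) (hS : IsStratifiedSample H P X σ G) {t : EuclideanSpace ℝ (Fin d)}
    (ht : t ∈ unitCube d) :
    ∫ ω, discrepancy (fun i => X i ω) t ^ 2 ∂P ≤ 2 * d / (N : ℝ) ^ (1 + 1 / (d : ℝ)) := by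
  have hprob := fun s : Fin N => hH.isProbabilityMeasure_cond hd s
  set p : Fin N → ℝ := fun s => (volume[|stratum H N s]).real (boxBelow t) with hp
  have hp0 : ∀ s, 0 ≤ p s := fun s => measureReal_nonneg
  have hp1 : ∀ s, p s ≤ 1 := fun s => measureReal_le_one
  set φ : Fin N → EuclideanSpace ℝ (Fin d) → ℝ :=
    fun s x => (boxBelow t).indicator 1 x - p s with hφdef
  have hφm : ∀ s, Measurable (φ s) := fun s =>
    (measurable_indicator_boxBelow measurable_id measurable_const).sub_const _
  have hφ1 : ∀ s x, |φ s x| ≤ 1 := by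
    intro s x
    have h1 := indicator_boxBelow_nonneg x t
    have h2 := indicator_boxBelow_le_one x t
    rw [hφdef, abs_le]
    constructor <;> dsimp only <;> linarith [hp0 s, hp1 s]
  have hind : ∀ s : Fin N, ∫ x, (boxBelow t).indicator (1 : EuclideanSpace ℝ (Fin d) → ℝ) x
      ∂(volume[|stratum H N s]) = p s := fun s => integral_indicator_one (measurableSet_boxBelow t)
  have hindi : ∀ s : Fin N, Integrable ((boxBelow t).indicator (1 : EuclideanSpace ℝ (Fin d) → ℝ))
      (volume[|stratum H N s]) := fun s =>
    (integrable_const (1 : ℝ)).indicator (measurableSet_boxBelow t)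
  have hφ0 : ∀ s : Fin N, ∫ x, φ s x ∂(volume[|stratum H N s]) = 0 := by
    intro s
    rw [hφdef]; dsimp only
    rw [integral_sub (hindi s) (integrable_const _), hind, integral_const]
    simp
  have hφ2 : ∀ s : Fin N, ∫ x, φ s x ^ 2 ∂(volume[|stratum H N s]) = p s - p s ^ 2 := by
    intro s
    have hsq : ∀ x, φ s x ^ 2 = (1 - 2 * p s) * (boxBelow t).indicator 1 x + p s ^ 2 := by
      intro x
      rw [hφdef]; dsimp only
      by_cases hx : x ∈ boxBelow t
      · rw [Set.indicator_of_mem hx]; simp only [Pi.one_apply]; ring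
      · rw [Set.indicator_of_notMem hx]; ring
    simp only [hsq]
    rw [integral_add ((hindi s).const_mul _) (integrable_const _), integral_const_mul, hind,
      integral_const]
    simp; ring
  set Z : Fin N → Ω → ℝ := fun i ω => φ (σ i ω) (X i ω) with hZ
  have hφu : Measurable (Function.uncurry φ) := measurable_from_prod_countable_right hφm
  have hZm : ∀ i, Measurable (Z i) := fun i =>
    hφu.comp (((hS.measurable_index i i).mono (hS.le i) le_rfl).prodMk (hS.measurable i))
  have hZG : ∀ i k, k ≠ i → Measurable[G i] (Z k) := fun i k hk =>
    hφu.comp ((hS.measurable_index i k).prodMk (hS.measurable_point i k hk))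
  have hZ1 : ∀ i ω, |Z i ω| ≤ 1 := fun i ω => hφ1 _ _
  have hZZ : ∀ i k, Integrable (fun ω => Z i ω * Z k ω) P := by
    intro i k
    refine Integrable.of_bound (C := 1) ((hZm i).mul (hZm k)).aestronglyMeasurable
      (Filter.Eventually.of_forall fun ω => ?_)
    rw [Real.norm_eq_abs, abs_mul]
    exact mul_le_one₀ (hZ1 i ω) (abs_nonneg _) (hZ1 k ω)
  have hoff : ∀ i k, k ≠ i → ∫ ω, Z i ω * Z k ω ∂P = 0 := by
    intro i k hk
    rw [hZ]; dsimp only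
    rw [hS.integral_mul i hφm hφ1 (hZG i k hk) (hZ1 k)]
    simp [hφ0]
  have hdiag : ∀ i, ∫ ω, Z i ω * Z i ω ∂P = ∫ ω, (p (σ i ω) - p (σ i ω) ^ 2) ∂P := by
    intro i
    have h1 := hS.integral_mul i (φ := fun s x => φ s x ^ 2) (C := 1) (W := fun _ => 1) (C' := 1)
      (fun s => (hφm s).pow_const 2)
      (fun s x => by rw [abs_pow]; exact pow_le_one₀ (abs_nonneg _) (hφ1 s x))
      (@measurable_const _ _ _ (G i) _) (fun ω => by simp)
    simp only [hφ2, mul_one] at h1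
    rw [← h1]
    exact integral_congr_ae (Filter.Eventually.of_forall fun ω => (sq (Z i ω)).symm)
  have hN' : (0 : ℝ) < N := by exact_mod_cast hN
  -- the centring terms add up to the volume of the box since every stratum is used once
  have hD : ∀ ω, discrepancy (fun i => X i ω) t = 1 / (N : ℝ) * ∑ i, Z i ω := by
    intro ω
    have hsum : ∑ i, p (σ i ω) = N * ∏ j, t j := by
      rw [(hS.bijective ω).sum_comp p, hp, hH.sum_cond_stratum hd hN (measurableSet_boxBelow t),
        ← integral_indicator_boxBelow ht, integral_indicator_one (measurableSet_boxBelow t)]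
    rw [discrepancy, hZ, hφdef]
    dsimp only
    rw [Finset.sum_sub_distrib, hsum]
    field_simp
  have hvar : ∀ i, Integrable (fun ω => p (σ i ω) - p (σ i ω) ^ 2) P := by
    intro i
    have hm : Measurable fun s : Fin N => p s - p s ^ 2 := measurable_of_finite _
    refine Integrable.of_bound (C := 1) (hm.comp
      ((hS.measurable_index i i).mono (hS.le i) le_rfl)).aestronglyMeasurable
      (Filter.Eventually.of_forall fun ω => ?_)
    rw [Real.norm_eq_abs, abs_le]
    constructor <;> nlinarith [hp0 (σ i ω), hp1 (σ i ω)]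
  have hmain : ∫ ω, (∑ i, Z i ω) ^ 2 ∂P = ∑ s : Fin N, (p s - p s ^ 2) := by
    calc ∫ ω, (∑ i, Z i ω) ^ 2 ∂P = ∫ ω, ∑ i, ∑ k, Z i ω * Z k ω ∂P := by
          simp only [sq, Finset.sum_mul_sum]
      _ = ∑ i, ∑ k, ∫ ω, Z i ω * Z k ω ∂P := by
          rw [integral_finsetSum _ fun i _ => integrable_finsetSum _ fun k _ => hZZ i k]
          exact Finset.sum_congr rfl fun i _ => integral_finsetSum _ fun k _ => hZZ i k
      _ = ∑ i, ∫ ω, (p (σ i ω) - p (σ i ω) ^ 2) ∂P := by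
          refine Finset.sum_congr rfl fun i _ => ?_
          rw [Finset.sum_eq_single i (fun k _ hk => hoff i k hk) (by simp), hdiag]
      _ = ∫ ω, ∑ i, (p (σ i ω) - p (σ i ω) ^ 2) ∂P :=
          (integral_finsetSum _ fun i _ => hvar i).symm
      _ = ∫ _ω, ∑ s : Fin N, (p s - p s ^ 2) ∂P := by
          refine integral_congr_ae (Filter.Eventually.of_forall fun ω => ?_)
          exact (hS.bijective ω).sum_comp fun s => p s - p s ^ 2
      _ = ∑ s : Fin N, (p s - p s ^ 2) := by simp
  simp only [hD, mul_pow]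
  rw [integral_const_mul, hmain]
  calc (1 / (N : ℝ)) ^ 2 * ∑ s : Fin N, (p s - p s ^ 2)
      ≤ (1 / (N : ℝ)) ^ 2 * (2 * d * N * (1 / (N : ℝ)) ^ (1 / (d : ℝ))) :=
        mul_le_mul_of_nonneg_left (hH.sum_variance_le hd t) (by positivity)
    _ = 2 * d / (N : ℝ) ^ (1 + 1 / (d : ℝ)) := by
        rw [Real.rpow_add hN', Real.rpow_one, Real.div_rpow zero_le_one hN'.le, Real.one_rpow]
        field_simp

theorem IsStratifiedSample.lintegral_sqWorstCaseError_le [IsProbabilityMeasure P] (hd : d ≠ 0)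
    (hH : IsHilbertCurve H) (hN : 0 < N) (hS : IsStratifiedSample H P X σ G) :
    ∫⁻ ω, sqWorstCaseError (fun i => X i ω) ∂P ≤
      ENNReal.ofReal (2 * d * √((d : ℝ) + 3) / (N : ℝ) ^ (1 + 1 / (d : ℝ))) := by
  have hDm : Measurable fun q : Ω × EuclideanSpace ℝ (Fin d) =>
      discrepancy (fun i => X i q.1) q.2 :=
    measurable_discrepancy (fun n => (hS.measurable n).comp measurable_fst) measurable_snd
  calc ∫⁻ ω, sqWorstCaseError (fun i => X i ω) ∂P
      ≤ ∫⁻ ω, ∫⁻ t, ENNReal.ofReal (discrepancy (fun i => X i ω) t ^ 2) ∂(cubeMeasure d) ∂P := by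
        refine lintegral_mono_ae ?_
        filter_upwards [ae_all_iff.2 (hS.ae_mem_unitCube hH)] with ω hω
          using sqWorstCaseError_le hω
    _ = ∫⁻ t, ∫⁻ ω, ENNReal.ofReal (discrepancy (fun i => X i ω) t ^ 2) ∂P ∂(cubeMeasure d) :=
        lintegral_lintegral_swap (hDm.pow_const 2).ennreal_ofReal.aemeasurable
    _ ≤ ∫⁻ _t, ENNReal.ofReal (2 * d / (N : ℝ) ^ (1 + 1 / (d : ℝ))) ∂(cubeMeasure d) := by
        refine lintegral_mono_ae ?_
        filter_upwards [HSFC.ae_mem_unitCube] with t ht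
        rw [← ofReal_integral_eq_lintegral_ofReal _
          (Filter.Eventually.of_forall fun ω => sq_nonneg _)]
        · exact ENNReal.ofReal_le_ofReal (hS.integral_discrepancy_sq_le hd hH hN ht)
        · refine Integrable.of_bound (C := 1) (((measurable_discrepancy hS.measurable
            measurable_const).pow_const 2).aestronglyMeasurable)
            (Filter.Eventually.of_forall fun ω => ?_)
          rw [Real.norm_eq_abs, abs_pow]
          exact pow_le_one₀ (abs_nonneg _) (abs_discrepancy_le _ ht)
    _ = ENNReal.ofReal (2 * d / (N : ℝ) ^ (1 + 1 / (d : ℝ))) := by simp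
    _ ≤ _ := by
        refine ENNReal.ofReal_le_ofReal ?_
        have h1 : (1 : ℝ) ≤ √((d : ℝ) + 3) :=
          Real.one_le_sqrt.2 (by linarith [Nat.cast_nonneg (α := ℝ) d])
        exact div_le_div_of_nonneg_right (le_mul_of_one_le_right (by positivity) h1)
          (by positivity)

lemma IsStratifiedSample.aemeasurable_sqWorstCaseError (hH : IsHilbertCurve H)
    (hS : IsStratifiedSample H P X σ G) :
    AEMeasurable (fun ω => sqWorstCaseError fun i => X i ω) P :=
  HSFC.aemeasurable_sqWorstCaseError (fun i => (hS.measurable i).aemeasurable)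
    (hS.ae_mem_unitCube hH)

end Sample

/-! ### Independent points, one in each stratum -/

section Independent

variable {d N : ℕ} {H : ℝ → EuclideanSpace ℝ (Fin d)} {Ω : Type*} [mΩ : MeasurableSpace Ω]
  {P : Measure Ω} {X : Fin N → Ω → EuclideanSpace ℝ (Fin d)}

lemma IsHilbertCurve.isStratifiedSample_of_iIndepFun (hX : ∀ i, Measurable (X i))
    (hu : ∀ i : Fin N, pdf.IsUniform (X i) (stratum H N i) P volume) (hi : iIndepFun X P) :
    IsStratifiedSample H P X (fun i _ => i)
      (fun i => ⨆ k ∈ ({i}ᶜ : Set (Fin N)), MeasurableSpace.comap (X k) inferInstance) where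
  le i := iSup₂_le fun k _ => (hX k).comap_le
  measurable_index i k := measurable_const
  measurable_point i k hk :=
    (comap_measurable (X k)).mono (le_iSup₂_of_le k hk le_rfl) le_rfl
  measurable := hX
  bijective _ := Function.bijective_id
  exists_uniform := by
    rintro i s ⟨ω, rfl⟩
    refine ⟨X i, hX i, hu i, ?_, fun _ _ => rfl⟩
    have h := indep_iSup_of_disjoint (fun k => (hX k).comap_le) hi.iIndep
      (disjoint_compl_right (a := ({i} : Set (Fin N))))
    rwa [iSup_singleton] at h

end Independent

/-! ### Base-`b` expansions with independent uniform digits -/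

section Digits

variable {b : ℕ}

/-- The integer with the `n` base-`b` digits `c`, the most significant digit first. -/
def digitIndex {n : ℕ} (c : Fin n → Fin b) : Fin (b ^ n) :=
  finFunctionFinEquiv fun k => c k.rev

lemma digitIndex_injective {n : ℕ} :
    Function.Injective (digitIndex : (Fin n → Fin b) → Fin (b ^ n)) := by
  intro c c' h
  funext k
  have := congrFun (finFunctionFinEquiv.injective h) k.rev
  simpa using this

/-- The first `n` digits determine the interval of length `b⁻ⁿ`, the other digits the position in
that interval. -/
lemma ofDigits_eq_digitIndex_add_div [NeZero b] (x : ℕ → Fin b) (n : ℕ) :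
    Real.ofDigits x = (((digitIndex fun k : Fin n => x k : Fin (b ^ n)) : ℕ) +
      Real.ofDigits fun k => x (k + n)) / ((b ^ n : ℕ) : ℝ) := by
  have hb : (b : ℝ) ≠ 0 := by exact_mod_cast NeZero.ne b
  rw [Real.ofDigits_eq_sum_add_ofDigits x n, digitIndex, finFunctionFinEquiv_apply, add_div]
  congr 1
  · push_cast
    rw [Finset.sum_div, ← Fin.sum_univ_eq_sum_range, ← Equiv.sum_comp Fin.revPerm]
    refine Finset.sum_congr rfl fun k _ => ?_
    rw [Real.ofDigitsTerm, Fin.revPerm_apply, Fin.val_rev, mul_div_assoc]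
    congr 1
    rw [inv_eq_one_div, div_eq_div_iff (by positivity) (by positivity), one_mul, ← pow_add]
    congr 1
    omega
  · push_cast
    rw [div_eq_inv_mul]

lemma measurable_ofDigits {α : Type*} [MeasurableSpace α] {V : α → ℕ → Fin b}
    (hV : ∀ k, Measurable fun a => V a k) : Measurable fun a => Real.ofDigits (V a) :=
  Real.continuous_ofDigits.measurable.comp (measurable_pi_iff.2 hV)

lemma measurable_digitIndex {α : Type*} [MeasurableSpace α] {n : ℕ} {V : α → Fin n → Fin b}
    (hV : ∀ k, Measurable fun a => V a k) : Measurable fun a => digitIndex (V a) :=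
  (measurable_of_finite (digitIndex : (Fin n → Fin b) → Fin (b ^ n))).comp (measurable_pi_iff.2 hV)

/-- A random expansion with independent, uniformly distributed digits is uniformly distributed on
`[0,1]`. -/
lemma map_ofDigits (hb : 2 ≤ b) {Ω : Type*} [MeasurableSpace Ω] {P : Measure Ω}
    [IsProbabilityMeasure P] {V : Ω → ℕ → Fin b} (hV : Measurable V)
    (hcyl : ∀ n (c : Fin n → Fin b),
      P {ω | ∀ k : Fin n, V ω k = c k} = ENNReal.ofReal (1 / ((b ^ n : ℕ) : ℝ))) :
    P.map (fun ω => Real.ofDigits (V ω)) = volume.restrict (Set.Icc 0 1) := by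
  have : NeZero b := ⟨by omega⟩
  have hU : Measurable fun ω => Real.ofDigits (V ω) := Real.continuous_ofDigits.measurable.comp hV
  have key : P.map (fun ω => Real.ofDigits (V ω)) = (volume.restrict (Set.Icc 0 1)).map id := by
    refine map_eq_map_of_cells hU.aemeasurable aemeasurable_id fun e he => ?_
    obtain ⟨n, hn⟩ := exists_div_two_pow_lt 1 he
    have hbn : (0 : ℝ) < ((b ^ n : ℕ) : ℝ) := by
      exact_mod_cast pow_pos (show 0 < b by omega) n
    have hpos : 0 < b ^ n := by positivity
    refine ⟨Fin n → Fin b, Finset.univ, fun c => {ω | ∀ k : Fin n, V ω k = c k},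
      fun c => Set.Icc (((digitIndex c : ℕ) : ℝ) / ((b ^ n : ℕ) : ℝ))
        ((((digitIndex c : ℕ) : ℝ) + 1) / ((b ^ n : ℕ) : ℝ)), ?_, ?_, ?_, ?_, ?_⟩
    · exact Filter.Eventually.of_forall fun ω => ⟨fun k => V ω k, Finset.mem_univ _, fun _ => rfl⟩
    · exact fun c _ => measurableSet_Icc.nullMeasurableSet
    · intro c _ c' _ hcc
      exact (subsingleton_Icc_div_inter hpos (Fin.val_ne_of_ne
        (digitIndex_injective.ne hcc))).measure_zero _
    · intro c _
      rw [hcyl, Measure.restrict_eq_self _ (Icc_div_subset (digitIndex c)), Real.volume_Icc,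
        ← sub_div, add_sub_cancel_left]
    · intro c _ ω hω x hx
      have h1 : (fun k : Fin n => V ω k) = c := funext hω
      have h2 := ofDigits_eq_digitIndex_add_div (V ω) n
      rw [h1] at h2
      have h3 := Real.ofDigits_nonneg fun k => V ω (k + n)
      have h4 := Real.ofDigits_le_one fun k => V ω (k + n)
      have h5 : 1 / ((b ^ n : ℕ) : ℝ) ≤ 1 / 2 ^ n := by
        push_cast
        exact one_div_le_one_div_of_le (by positivity)
          (pow_le_pow_left₀ (by norm_num) (by exact_mod_cast hb) n)
      obtain ⟨hx1, hx2⟩ := hx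
      have h6 := div_nonneg h3 hbn.le
      have h7 := div_le_div_of_nonneg_right h4 hbn.le
      rw [add_div] at h2 hx2
      rw [id, Real.dist_eq, h2, abs_le]
      constructor <;> linarith
  rwa [Measure.map_id] at key

end Digits

/-! ### Scrambled van der Corput points -/

section Scrambling

variable {b : ℕ}

lemma card_perm_apply_eq (a c : Fin b) :
    b * (Finset.univ.filter fun τ : Equiv.Perm (Fin b) => τ a = c).card = b.factorial := by
  have h1 := Finset.card_eq_sum_card_fiberwise (s := (Finset.univ : Finset (Equiv.Perm (Fin b))))
    (t := Finset.univ) (f := fun τ => τ a) (fun _ _ => Finset.mem_coe.2 (Finset.mem_univ _))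
  rw [Finset.card_univ, Fintype.card_perm, Fintype.card_fin] at h1
  rw [h1]
  have h2 : ∀ c' ∈ (Finset.univ : Finset (Fin b)),
      (Finset.univ.filter fun τ : Equiv.Perm (Fin b) => τ a = c').card =
        (Finset.univ.filter fun τ : Equiv.Perm (Fin b) => τ a = c).card := by
    intro c' _
    refine Finset.card_equiv (Equiv.mulLeft (Equiv.swap c c')) fun τ => ?_
    simp only [Finset.mem_filter, Finset.mem_univ, true_and, Equiv.coe_mulLeft,
      Equiv.Perm.coe_mul, Function.comp_apply]
    rw [Equiv.swap_apply_eq_iff, Equiv.swap_apply_left]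
  rw [Finset.sum_congr rfl h2]
  simp

/-- The σ-algebra generated by the permutation `π w`. -/
abbrev permSigma {Ω : Type*} (π : List (Fin b) → Ω → Equiv.Perm (Fin b)) (w : List (Fin b)) :
    MeasurableSpace Ω :=
  MeasurableSpace.comap (π w) ⊤

lemma measurable_permSigma {Ω : Type*} {π : List (Fin b) → Ω → Equiv.Perm (Fin b)}
    (w : List (Fin b)) (a : Fin b) :
    Measurable[permSigma π w] fun ω => π w ω a := by
  intro S _
  exact ⟨{τ | τ a ∈ S}, trivial, rfl⟩

variable {Ω : Type*} [mΩ : MeasurableSpace Ω] {P : Measure Ω}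
  {π : List (Fin b) → Ω → Equiv.Perm (Fin b)}

lemma IsUniformScrambling.permSigma_le (hπ : IsUniformScrambling π P) (w : List (Fin b)) :
    permSigma π w ≤ mΩ := by
  rintro _ ⟨S, -, rfl⟩
  have h : π w ⁻¹' S = ⋃ τ ∈ S, {ω | π w ω = τ} := by ext ω; simp
  rw [h]
  exact MeasurableSet.biUnion S.to_countable fun τ _ => hπ.measurableSet_eq w τ

lemma IsUniformScrambling.measure_apply_eq (hπ : IsUniformScrambling π P) (w : List (Fin b))
    (a c : Fin b) : P {ω | π w ω a = c} = (b : ℝ≥0∞)⁻¹ := by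
  have h : {ω | π w ω a = c} =
      ⋃ τ ∈ Finset.univ.filter fun τ : Equiv.Perm (Fin b) => τ a = c, {ω | π w ω = τ} := by
    ext ω; simp
  rw [h, measure_biUnion_finset]
  · rw [Finset.sum_congr rfl fun τ _ => hπ.uniform w τ, Finset.sum_const, nsmul_eq_mul,
      ← card_perm_apply_eq a c]
    have hb : (b : ℝ≥0∞) ≠ 0 := by exact_mod_cast a.pos.ne'
    have hcard : ((Finset.univ.filter fun τ : Equiv.Perm (Fin b) => τ a = c).card : ℝ≥0∞) ≠ 0 := by
      intro h0
      have h1 := card_perm_apply_eq a c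
      rw [Nat.cast_eq_zero.1 h0, mul_zero] at h1
      exact b.factorial_ne_zero h1.symm
    push_cast
    rw [ENNReal.mul_inv (Or.inl hb) (Or.inl (ENNReal.natCast_ne_top b)), mul_left_comm,
      ENNReal.mul_inv_cancel hcard (ENNReal.natCast_ne_top _), mul_one]
  · intro τ _ τ' _ hne
    exact Set.disjoint_left.2 fun ω h1 h2 => hne (h1.symm.trans h2)
  · exact fun τ _ => hπ.measurableSet_eq w τ

lemma IsUniformScrambling.measure_forall_apply_eq (hπ : IsUniformScrambling π P) {n : ℕ}
    {w : Fin n → List (Fin b)} (hw : Function.Injective w) (a c : Fin n → Fin b) :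
    P {ω | ∀ k, π (w k) ω (a k) = c k} = ENNReal.ofReal (1 / ((b ^ n : ℕ) : ℝ)) := by
  have h := iIndep.meas_biInter (S := Finset.univ) (hπ.indep.precomp hw).iIndep
    (s := fun k => {ω | π (w k) ω (a k) = c k})
    (fun k _ => ⟨{τ | τ (a k) = c k}, trivial, rfl⟩)
  have hset : {ω | ∀ k, π (w k) ω (a k) = c k} =
      ⋂ k ∈ Finset.univ, {ω | π (w k) ω (a k) = c k} := by ext ω; simp
  rw [hset, h, Finset.prod_congr rfl fun k _ => hπ.measure_apply_eq (w k) (a k) (c k),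
    Finset.prod_const, Finset.card_univ, Fintype.card_fin]
  rcases Nat.eq_zero_or_pos n with rfl | hn
  · simp
  · have hb : 0 < b := (a ⟨0, hn⟩).pos
    have hbn : (0 : ℝ) < ((b ^ n : ℕ) : ℝ) := by exact_mod_cast pow_pos hb n
    rw [one_div, ENNReal.ofReal_inv_of_pos hbn, ENNReal.ofReal_natCast, Nat.cast_pow,
      ENNReal.inv_pow]

variable [NeZero b]

/-- The word formed by the first `j` digits of the `i`-th van der Corput point. -/
def vdcPrefix (b : ℕ) [NeZero b] (i j : ℕ) : List (Fin b) := (List.range j).map (vdcDigit b i)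

lemma length_vdcPrefix (i j : ℕ) : (vdcPrefix b i j).length = j := by
  simp [vdcPrefix]

lemma vdcPrefix_eq_iff {i k j : ℕ} :
    vdcPrefix b i j = vdcPrefix b k j ↔ ∀ l < j, vdcDigit b i l = vdcDigit b k l := by
  simp [vdcPrefix, List.map_inj_left]

lemma eq_of_vdcDigit_eq {m : ℕ} {i k : Fin (b ^ m)}
    (h : ∀ l < m, vdcDigit b i l = vdcDigit b k l) : i = k := by
  apply finFunctionFinEquiv.symm.injective
  funext l
  apply Fin.ext
  rw [finFunctionFinEquiv_symm_apply_val, finFunctionFinEquiv_symm_apply_val]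
  exact congrArg Fin.val (h l l.isLt)

lemma scrambledPoint_eq_ofDigits (τ : List (Fin b) → Equiv.Perm (Fin b)) (i : ℕ) :
    scrambledPoint τ i = Real.ofDigits (scrambledDigit τ i) :=
  tsum_congr fun _ => div_eq_mul_inv _ _

/-- Scrambling permutes the words of length `m`, since each digit is permuted in a way that depends
only on the preceding digits. -/
lemma bijective_digitIndex_scrambledDigit (τ : List (Fin b) → Equiv.Perm (Fin b)) (m : ℕ) :
    Function.Bijective fun i : Fin (b ^ m) => digitIndex fun k : Fin m => scrambledDigit τ i k := by
  rw [← Finite.injective_iff_bijective]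
  intro i k hik
  have hdig : ∀ l < m, scrambledDigit τ i l = scrambledDigit τ k l := fun l hl =>
    congrFun (digitIndex_injective hik) ⟨l, hl⟩
  refine eq_of_vdcDigit_eq fun l => ?_
  induction l using Nat.strong_induction_on with
  | _ l ih =>
    intro hl
    have h1 := hdig l hl
    have h2 : vdcPrefix b i l = vdcPrefix b k l :=
      vdcPrefix_eq_iff.2 fun r hr => ih r hr (hr.trans hl)
    change τ (vdcPrefix b i l) _ = τ (vdcPrefix b k l) _ at h1
    rw [h2] at h1
    exact (τ _).injective h1

end Scrambling

/-! ### The scrambled sample is stratified -/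

lemma map_affine_restrict_Icc {N : ℕ} (s : Fin N) :
    (volume.restrict (Set.Icc (0 : ℝ) 1)).map (fun u => ((s : ℝ) + u) / N) =
      (N : ℝ≥0∞) • volume.restrict (Set.Icc ((s : ℝ) / N) (((s : ℝ) + 1) / N)) := by
  have hN : (0 : ℝ) < N := by exact_mod_cast s.pos
  have hpre : (fun u : ℝ => ((s : ℝ) + u) / N) ⁻¹'
      Set.Icc ((s : ℝ) / N) (((s : ℝ) + 1) / N) = Set.Icc 0 1 := by
    ext u
    simp only [Set.mem_preimage, Set.mem_Icc]
    rw [div_le_div_iff_of_pos_right hN, div_le_div_iff_of_pos_right hN]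
    constructor <;> rintro ⟨h1, h2⟩ <;> constructor <;> linarith
  have hm : Measurable fun u : ℝ => ((s : ℝ) + u) / N := by fun_prop
  rw [← hpre, ← Measure.restrict_map hm measurableSet_Icc]
  have hvol : (volume : Measure ℝ).map (fun u => ((s : ℝ) + u) / N) = (N : ℝ≥0∞) • volume := by
    have hcomp : (fun u : ℝ => ((s : ℝ) + u) / N) =
        (fun x => (N : ℝ)⁻¹ * x) ∘ fun u => (s : ℝ) + u := by
      funext u
      rw [Function.comp_apply, div_eq_inv_mul]
    rw [hcomp, ← Measure.map_map (by fun_prop) (by fun_prop), map_add_left_eq_self,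
      Real.map_volume_mul_left (inv_ne_zero hN.ne'), inv_inv, abs_of_pos hN,
      ENNReal.ofReal_natCast]
  rw [hvol, Measure.restrict_smul]

section Curve

variable {d N : ℕ} {H : ℝ → EuclideanSpace ℝ (Fin d)}

/-- The curve `H`, extended from `[0,1]` to a function on `ℝ` that is constant on either side. -/
noncomputable def extendCurve (H : ℝ → EuclideanSpace ℝ (Fin d)) (x : ℝ) :
    EuclideanSpace ℝ (Fin d) :=
  H (Set.projIcc (0 : ℝ) 1 zero_le_one x)

lemma extendCurve_of_mem {x : ℝ} (hx : x ∈ Set.Icc (0 : ℝ) 1) : extendCurve H x = H x := by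
  rw [extendCurve, Set.projIcc_of_mem zero_le_one hx]

lemma IsHilbertCurve.continuous_extendCurve (hH : IsHilbertCurve H) :
    Continuous (extendCurve H) :=
  hH.continuousOn.comp_continuous (continuous_subtype_val.comp continuous_projIcc)
    fun x => (Set.projIcc (0 : ℝ) 1 zero_le_one x).2

lemma IsHilbertCurve.isUniform_extendCurve (hd : d ≠ 0) (hH : IsHilbertCurve H) {Ω : Type*}
    [MeasurableSpace Ω] {P : Measure Ω} {U : Ω → ℝ} (hU : Measurable U)
    (hUP : P.map U = volume.restrict (Set.Icc 0 1)) (s : Fin N) :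
    pdf.IsUniform (fun ω => extendCurve H (((s : ℝ) + U ω) / N)) (stratum H N s) P volume := by
  have hm : Measurable fun u : ℝ => ((s : ℝ) + u) / N := by fun_prop
  have hc : Measurable (extendCurve H) := hH.continuous_extendCurve.measurable
  have hcomp : (fun ω => extendCurve H (((s : ℝ) + U ω) / N)) =
      extendCurve H ∘ (fun u : ℝ => ((s : ℝ) + u) / N) ∘ U := rfl
  have hcongr : (volume.restrict (Set.Icc ((s : ℝ) / N) (((s : ℝ) + 1) / N))).map (extendCurve H) =
      (volume.restrict (Set.Icc ((s : ℝ) / N) (((s : ℝ) + 1) / N))).map H := by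
    refine Measure.map_congr ?_
    filter_upwards [ae_restrict_mem measurableSet_Icc] with x hx
      using extendCurve_of_mem (Icc_div_subset s hx)
  rw [pdf.IsUniform, hcomp, ← Measure.map_map hc (hm.comp hU), ← Measure.map_map hm hU, hUP,
    map_affine_restrict_Icc, Measure.map_smul, hcongr, hH.map_restrict_Icc hd (Icc_div_subset s),
    ProbabilityTheory.cond, hH.volume_stratum hd, inv_inv, stratum]

end Curve

section Scrambling

variable {b m : ℕ} [NeZero b]

/-- The words of length at least `m` whose permutations scramble the `i`-th van der Corput point;
they determine the position of the scrambled point in its interval of length `b⁻ᵐ`. -/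
def tailWords (b m : ℕ) [NeZero b] (i : ℕ) : Set (List (Fin b)) :=
  Set.range fun k => vdcPrefix b i (k + m)

lemma vdcPrefix_notMem_tailWords_of_lt {i k l : ℕ} (hl : l < m) :
    vdcPrefix b k l ∉ tailWords b m i := by
  rintro ⟨r, hr⟩
  have h := congrArg List.length hr
  simp only [length_vdcPrefix] at h
  omega

lemma vdcPrefix_notMem_tailWords_of_ne {i k : Fin (b ^ m)} (hik : k ≠ i) (l : ℕ) :
    vdcPrefix b k l ∉ tailWords b m i := by
  rintro ⟨r, hr⟩
  have h := congrArg List.length hr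
  simp only [length_vdcPrefix] at h
  subst h
  exact hik (eq_of_vdcDigit_eq fun j hj => (vdcPrefix_eq_iff.1 hr j (by omega)).symm)

lemma measurable_scrambledDigit {Ω : Type*} {π : List (Fin b) → Ω → Equiv.Perm (Fin b)}
    {S : Set (List (Fin b))} {i j : ℕ} (h : vdcPrefix b i j ∈ S) :
    Measurable[⨆ w ∈ S, permSigma π w] fun ω => scrambledDigit (fun w => π w ω) i j :=
  (measurable_permSigma (π := π) (vdcPrefix b i j) (vdcDigit b i j)).mono
    (le_iSup₂_of_le _ h le_rfl) le_rfl

lemma scrambledPoint_mem (τ : List (Fin b) → Equiv.Perm (Fin b)) (i : ℕ) :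
    scrambledPoint τ i ∈ Set.Icc (0 : ℝ) 1 := by
  rw [scrambledPoint_eq_ofDigits]
  exact ⟨Real.ofDigits_nonneg _, Real.ofDigits_le_one _⟩

variable {Ω : Type*} [mΩ : MeasurableSpace Ω] {P : Measure Ω}
  {π : List (Fin b) → Ω → Equiv.Perm (Fin b)}

lemma IsUniformScrambling.map_ofDigits_tail [IsProbabilityMeasure P] (hb : 2 ≤ b)
    (hπ : IsUniformScrambling π P) (i : ℕ) :
    P.map (fun ω => Real.ofDigits fun k => scrambledDigit (fun w => π w ω) i (k + m)) =
      volume.restrict (Set.Icc 0 1) := by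
  refine map_ofDigits hb (measurable_pi_iff.2 fun k => ?_) fun n c => ?_
  · exact (measurable_permSigma (π := π) _ _).mono (hπ.permSigma_le _) le_rfl
  · refine hπ.measure_forall_apply_eq (w := fun k : Fin n => vdcPrefix b i (k + m)) ?_
      (fun k => vdcDigit b i (k + m)) c
    intro k l hkl
    have h := congrArg List.length hkl
    simp only [length_vdcPrefix] at h
    exact Fin.ext (by omega)

/-- The first `m` scrambled digits select the stratum, the remaining ones a uniformly distributed
point in it, and the latter involve permutations used by no other point. -/
lemma IsUniformScrambling.isStratifiedSample [IsProbabilityMeasure P] {d : ℕ} (hd : d ≠ 0)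
    (hb : 2 ≤ b) {H : ℝ → EuclideanSpace ℝ (Fin d)} (hH : IsHilbertCurve H)
    (hπ : IsUniformScrambling π P) :
    IsStratifiedSample H P
      (fun (i : Fin (b ^ m)) ω => extendCurve H (scrambledPoint (fun w => π w ω) i))
      (fun i ω => digitIndex fun k : Fin m => scrambledDigit (fun w => π w ω) i k)
      (fun i => ⨆ w ∈ (tailWords b m i)ᶜ, permSigma π w) where
  le i := iSup₂_le fun w _ => hπ.permSigma_le w
  measurable_index i k := by
    refine @measurable_digitIndex _ _ (_) _ _ fun l => ?_
    exact measurable_scrambledDigit (vdcPrefix_notMem_tailWords_of_lt l.isLt)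
  measurable_point i k hk := by
    simp only [scrambledPoint_eq_ofDigits]
    refine hH.continuous_extendCurve.measurable.comp
      (@measurable_ofDigits _ _ (_) _ fun l => ?_)
    exact measurable_scrambledDigit (vdcPrefix_notMem_tailWords_of_ne hk l)
  measurable i := by
    simp only [scrambledPoint_eq_ofDigits]
    refine hH.continuous_extendCurve.measurable.comp (measurable_ofDigits fun l => ?_)
    exact (measurable_permSigma (π := π) _ _).mono (hπ.permSigma_le _) le_rfl
  bijective ω := bijective_digitIndex_scrambledDigit _ m
  exists_uniform := by
    intro i s _
    set U : Ω → ℝ := fun ω =>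
      Real.ofDigits fun k => scrambledDigit (fun w => π w ω) i (k + m) with hU
    have hUm : Measurable[⨆ w ∈ tailWords b m i, permSigma π w] U :=
      @measurable_ofDigits _ _ (_) _ fun k => measurable_scrambledDigit (Set.mem_range_self k)
    have hUm' : Measurable U := hUm.mono (iSup₂_le fun w _ => hπ.permSigma_le w) le_rfl
    have hg : Measurable fun u : ℝ => extendCurve H (((s : ℝ) + u) / ((b ^ m : ℕ) : ℝ)) :=
      hH.continuous_extendCurve.measurable.comp (by fun_prop)
    refine ⟨fun ω => extendCurve H (((s : ℝ) + U ω) / ((b ^ m : ℕ) : ℝ)), hg.comp hUm',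
      hH.isUniform_extendCurve hd hUm' (hπ.map_ofDigits_tail hb i) s, ?_, ?_⟩
    · exact indep_of_indep_of_le_left (indep_iSup_of_disjoint hπ.permSigma_le hπ.indep.iIndep
        disjoint_compl_right) (hg.comp hUm).comap_le
    · rintro ω rfl
      rw [scrambledPoint_eq_ofDigits, ofDigits_eq_digitIndex_add_div _ m]

end Scrambling

end HSFC
theorem mainTheorem3 (d b m N : ℕ) [NeZero b] (hd : 2 ≤ d) (hb : 2 ≤ b) (hm : 2 ≤ m)
    (hN : N = b ^ m)
    (H : ℝ → EuclideanSpace ℝ (Fin d)) (hH : HSFC.IsHilbertCurve H)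
    {Ω : Type*} [MeasurableSpace Ω] (P : Measure Ω) [IsProbabilityMeasure P] :
    -- the strata form an equal-measure partition of the unit cube, up to null sets
    ((⋃ i : Fin N, HSFC.stratum H N i) = HSFC.unitCube d ∧
      (∀ i : Fin N, volume (HSFC.stratum H N i) = (N : ℝ≥0∞)⁻¹) ∧
      Pairwise fun i j : Fin N => AEDisjoint volume (HSFC.stratum H N i) (HSFC.stratum H N j)) ∧
    -- independent samples, one uniformly distributed in each stratum
    (∀ X : Fin N → Ω → EuclideanSpace ℝ (Fin d),
      (∀ i : Fin N, pdf.IsUniform (X i) (HSFC.stratum H N i) P volume) → iIndepFun X P →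
      AEMeasurable (fun ω => HSFC.sqWorstCaseError fun i => X i ω) P ∧
      ∫⁻ ω, HSFC.sqWorstCaseError (fun i => X i ω) ∂P ≤
        ENNReal.ofReal (2 * d * √((d : ℝ) + 3) / (N : ℝ) ^ (1 + 1 / (d : ℝ)))) ∧
    -- scrambled van der Corput points mapped by the Hilbert curve
    (∀ π : List (Fin b) → Ω → Equiv.Perm (Fin b), HSFC.IsUniformScrambling π P →
      AEMeasurable (fun ω => HSFC.sqWorstCaseError fun i : Fin N =>
        H (HSFC.scrambledPoint (fun w => π w ω) i)) P ∧
      ∫⁻ ω, HSFC.sqWorstCaseError (fun i : Fin N =>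
        H (HSFC.scrambledPoint (fun w => π w ω) i)) ∂P ≤
        ENNReal.ofReal (2 * d * √((d : ℝ) + 3) / (N : ℝ) ^ (1 + 1 / (d : ℝ)))) := by
  subst hN
  have hd0 : d ≠ 0 := by omega
  have hN0 : 0 < b ^ m := pow_pos (by omega) m
  refine ⟨⟨hH.iUnion_stratum hN0, hH.volume_stratum hd0, hH.aedisjoint_stratum hd0⟩, ?_, ?_⟩
  · intro X hX hind
    have hXm : ∀ i, AEMeasurable (X i) P := fun i =>
      (hX i).aemeasurable (by rw [hH.volume_stratum hd0]; simp)
        (hH.isCompact_stratum i).measure_lt_top.ne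
    -- pass to measurable versions of the points
    have hS := HSFC.IsHilbertCurve.isStratifiedSample_of_iIndepFun (H := H)
      (fun i => (hXm i).measurable_mk)
      (fun i => (Measure.map_congr (hXm i).ae_eq_mk).symm.trans (hX i))
      (hind.congr fun i => (hXm i).ae_eq_mk)
    have hae : (fun ω => HSFC.sqWorstCaseError fun i => X i ω) =ᵐ[P]
        fun ω => HSFC.sqWorstCaseError fun i => (hXm i).mk (X i) ω := by
      filter_upwards [ae_all_iff.2 fun i => (hXm i).ae_eq_mk] with ω hω
      exact congrArg HSFC.sqWorstCaseError (funext hω)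
    refine ⟨(hS.aemeasurable_sqWorstCaseError hH).congr hae.symm, ?_⟩
    rw [lintegral_congr_ae hae]
    exact hS.lintegral_sqWorstCaseError_le hd0 hH hN0
  · intro π hπ
    have hS := hπ.isStratifiedSample (m := m) hd0 hb hH
    have heq : (fun ω => HSFC.sqWorstCaseError fun i : Fin (b ^ m) =>
        H (HSFC.scrambledPoint (fun w => π w ω) i)) =
        fun ω => HSFC.sqWorstCaseError fun i : Fin (b ^ m) =>
          HSFC.extendCurve H (HSFC.scrambledPoint (fun w => π w ω) i) := by
      funext ω
      congr 1
      funext i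
      exact (HSFC.extendCurve_of_mem (HSFC.scrambledPoint_mem _ _)).symm
    rw [heq]
    exact ⟨hS.aemeasurable_sqWorstCaseError hH, hS.lintegral_sqWorstCaseError_le hd0 hH hN0⟩
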